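/- Let $k$ be an algebraically closed field of characteristic zero and let $X$ be a variety over $k$, i.e. an integral scheme of finite type over $k$. Put $d=\dim X$, let $\Omega_{X/k}$ be the sheaf of differentials, and let $g\colon G\to X$ be Grothendieck's Grassmannian $\mathrm{Grass}_d(\Omega_{X/k})$, which parametrizes the locally free quotients of rank $d$ of (pullbacks of) $\Omega_{X/k}$. Over the set $X_{\mathrm{reg}}$ of regular points, $\Omega_{X/k}$ is locally free of rank $d$, so its identity quotient defines a section $\sigma\colon X_{\mathrm{reg}}\to G$ of $g$, whose image is $g^{-1}(X_{\mathrm{reg}})$. The Nash modification $\pi\colon\mathcal N(X)\to X$ is the closure $\mathcal N(X)$ of $\sigma(X_{\mathrm{reg}})$ in $G$, with its reduced scheme structure, together with the restriction $\pi$ of $g$. Then $\pi$ is an isomorphism if and only if $X$ is regular, i.e. the local ring $\mathcal O_{X,x}$ is regular for every closed point $x\in X$. -/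

import Mathlib

universe u

open CategoryTheory Limits AlgebraicGeometry

noncomputable section

namespace NashModification

/-! ### Affine charts of the Grassmannian of rank `d` quotients of a module -/

section ChartRing

variable (R : Type u) [CommRing R] (M : Type u) [AddCommGroup M] [Module R M] {d : ℕ}
  (S : Finset (Fin d → M))

/-- The defining relations of the chart ring, in the variables `(s, m, i)`: "the `i`-th coordinate
of the image of `m` in the quotient, with respect to the basis given by the images of the tuple
`s`". These coordinates are additive and `R`-linear in `m`, the members of `s` have the standard
basis vectors as coordinates with respect to `s`, and passing from the basis `s` to the basis `t`
is multiplication by the matrix of the `t`-coordinates of `s`. -/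
inductive ChartRel : MvPolynomial (S × M × Fin d) R → Prop
  | add (s : S) (m n : M) (i : Fin d) :
      ChartRel (MvPolynomial.X (s, m + n, i) -
        (MvPolynomial.X (s, m, i) + MvPolynomial.X (s, n, i)))
  | smul (s : S) (r : R) (m : M) (i : Fin d) :
      ChartRel (MvPolynomial.X (s, r • m, i) - MvPolynomial.C r * MvPolynomial.X (s, m, i))
  | self (s : S) (j i : Fin d) :
      ChartRel (MvPolynomial.X (s, s.1 j, i) - MvPolynomial.C (if j = i then 1 else 0))
  | change (s t : S) (m : M) (i : Fin d) :
      ChartRel (MvPolynomial.X (t, m, i) -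
        ∑ j, MvPolynomial.X (s, m, j) * MvPolynomial.X (t, s.1 j, i))

/-- Let `S` be a nonempty finite set of `d`-tuples in the `R`-module `M`. The chart ring is the
`R`-algebra representing the functor that sends an `R`-algebra `B` to the set of quotients
`B ⊗ M → Q` (up to isomorphism) such that every tuple in `S` becomes a `B`-basis of `Q`; such a `Q`
is free of rank `d`, and it is the same as a compatible system of coordinate maps `M → Bᵈ`, one for
each of the bases `s ∈ S`. For `S = {s}` its spectrum is the standard affine chart of the
Grassmannian of rank `d` quotients of `M` where `s` is a basis of the quotient, and for general `S`
it is the intersection of the charts belonging to the members of `S`. -/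
abbrev ChartRing : Type u :=
  MvPolynomial (S × M × Fin d) R ⧸ Ideal.span {p | ChartRel R M S p}

variable {R M S}

/-- The universal coordinates on a chart: the `i`-th coordinate of `m` in the basis `s`. -/
def coord (s : S) (m : M) (i : Fin d) : ChartRing R M S :=
  Ideal.Quotient.mk _ (MvPolynomial.X (s, m, i))

lemma mk_eq_zero {p : MvPolynomial (S × M × Fin d) R} (h : ChartRel R M S p) :
    (Ideal.Quotient.mk (Ideal.span {p | ChartRel R M S p})) p = 0 :=
  Ideal.Quotient.eq_zero_iff_mem.mpr (Ideal.subset_span h)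

lemma coord_add (s : S) (m n : M) (i : Fin d) :
    coord (R := R) s (m + n) i = coord s m i + coord s n i := by
  have := mk_eq_zero (ChartRel.add (R := R) s m n i)
  rwa [map_sub, map_add, sub_eq_zero] at this

lemma coord_smul (s : S) (r : R) (m : M) (i : Fin d) :
    coord (R := R) s (r • m) i = algebraMap R _ r * coord s m i := by
  have := mk_eq_zero (ChartRel.smul (R := R) s r m i)
  rwa [map_sub, map_mul, sub_eq_zero] at this

lemma coord_self (s : S) (j i : Fin d) :
    coord (R := R) s (s.1 j) i = if j = i then 1 else 0 := by
  have := mk_eq_zero (ChartRel.self (R := R) s j i)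
  rw [map_sub, sub_eq_zero] at this
  refine this.trans ?_
  split_ifs <;> simp

lemma coord_change (s t : S) (m : M) (i : Fin d) :
    coord (R := R) t m i = ∑ j, coord s m j * coord t (s.1 j) i := by
  have := mk_eq_zero (ChartRel.change (R := R) s t m i)
  rw [map_sub, map_sum, sub_eq_zero] at this
  refine this.trans (Finset.sum_congr rfl fun j _ ↦ ?_)
  exact map_mul _ _ _

section lift

variable {B : Type u} [CommRing B] (φ : R →+* B) (c : S → M → Fin d → B)

/-- The universal property of the chart ring: a compatible system of coordinate functions with
values in `B` is the same as a ring homomorphism to `B`. -/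
def ChartRing.lift (h_add : ∀ s m n i, c s (m + n) i = c s m i + c s n i)
    (h_smul : ∀ s (r : R) m i, c s (r • m) i = φ r * c s m i)
    (h_self : ∀ (s : S) j i, c s (s.1 j) i = if j = i then 1 else 0)
    (h_change : ∀ (s t : S) m i, c t m i = ∑ j, c s m j * c t (s.1 j) i) :
    ChartRing R M S →+* B :=
  Ideal.Quotient.lift _ (MvPolynomial.eval₂Hom φ fun x ↦ c x.1 x.2.1 x.2.2) (by
    suffices Ideal.span {p | ChartRel R M S p} ≤
      RingHom.ker (MvPolynomial.eval₂Hom φ fun x ↦ c x.1 x.2.1 x.2.2) from fun a ha ↦ this ha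
    rw [Ideal.span_le]
    rintro _ (⟨s, m, n, i⟩ | ⟨s, r, m, i⟩ | ⟨s, j, i⟩ | ⟨s, t, m, i⟩)
    · simp [h_add]
    · simp [h_smul]
    · simp only [SetLike.mem_coe, RingHom.mem_ker, map_sub, MvPolynomial.coe_eval₂Hom,
        MvPolynomial.eval₂_X, MvPolynomial.eval₂_C, h_self]
      split_ifs <;> simp
    · simp only [SetLike.mem_coe, RingHom.mem_ker, map_sub, MvPolynomial.coe_eval₂Hom,
        MvPolynomial.eval₂_X, MvPolynomial.eval₂_sum, MvPolynomial.eval₂_mul]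
      exact sub_eq_zero.mpr (h_change s t m i))

variable (h_add : ∀ s m n i, c s (m + n) i = c s m i + c s n i)
    (h_smul : ∀ s (r : R) m i, c s (r • m) i = φ r * c s m i)
    (h_self : ∀ (s : S) j i, c s (s.1 j) i = if j = i then 1 else 0)
    (h_change : ∀ (s t : S) m i, c t m i = ∑ j, c s m j * c t (s.1 j) i)

@[simp] lemma ChartRing.lift_algebraMap (r : R) :
    ChartRing.lift φ c h_add h_smul h_self h_change (algebraMap R _ r) = φ r :=
  (Ideal.Quotient.lift_mk _ _ _).trans (MvPolynomial.eval₂_C _ _ _)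

@[simp] lemma ChartRing.lift_coord (s : S) (m : M) (i : Fin d) :
    ChartRing.lift φ c h_add h_smul h_self h_change (coord s m i) = c s m i :=
  (Ideal.Quotient.lift_mk _ _ _).trans (MvPolynomial.eval₂_X _ _ _)

end lift

lemma ChartRing.hom_ext {B : Type u} [CommRing B] {α β : ChartRing R M S →+* B}
    (h : ∀ r, α (algebraMap R _ r) = β (algebraMap R _ r))
    (h' : ∀ s m i, α (coord s m i) = β (coord s m i)) : α = β := by
  refine Ideal.Quotient.ringHom_ext (MvPolynomial.ringHom_ext h ?_)
  rintro ⟨s, m, i⟩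
  exact h' s m i

section map

variable {R' : Type u} [CommRing R'] {M' : Type u} [AddCommGroup M'] [Module R' M']
  {S' : Finset (Fin d → M')} (φ : R →+* R') (r : M →ₛₗ[φ] M') (h : ∀ s ∈ S, r ∘ s ∈ S')

/-- The chart ring is functorial in the ring, the module and the set of tuples. -/
def ChartRing.map : ChartRing R M S →+* ChartRing R' M' S' :=
  ChartRing.lift ((algebraMap R' _).comp φ) (fun s m i ↦ coord ⟨r ∘ s.1, h s.1 s.2⟩ (r m) i)
    (fun s m n i ↦ by simp [coord_add]) (fun s a m i ↦ by simp [coord_smul])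
    (fun s j i ↦ coord_self (S := S') ⟨r ∘ s.1, h s.1 s.2⟩ j i)
    (fun s t m i ↦ coord_change (S := S') ⟨r ∘ s.1, h s.1 s.2⟩ _ _ i)

@[simp] lemma ChartRing.map_algebraMap (a : R) :
    ChartRing.map φ r h (algebraMap R _ a) = algebraMap R' _ (φ a) :=
  ChartRing.lift_algebraMap ..

@[simp] lemma ChartRing.map_coord (s : S) (m : M) (i : Fin d) :
    ChartRing.map φ r h (coord s m i) = coord ⟨r ∘ s.1, h s.1 s.2⟩ (r m) i :=
  ChartRing.lift_coord ..

end map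

/-- The `d × d` matrix of coordinates of the tuple `s`. -/
def mat {B : Type u} [CommRing B] (c : M → Fin d → B) (s : Fin d → M) : Matrix (Fin d) (Fin d) B :=
  Matrix.of fun j i ↦ c (s j) i

lemma mat_mul_mat (s t : S) :
    mat (coord (R := R) s) t.1 * mat (coord (R := R) t) s.1 = 1 := by
  ext a b
  rw [Matrix.mul_apply, Matrix.one_apply, ← coord_self (R := R) t a b]
  exact (coord_change s t (t.1 a) b).symm

section localization

lemma exists_lift {R' : Type u} [CommRing R'] [Algebra R R'] {M' : Type u} [AddCommGroup M']
    [Module R' M'] (g : R) (r : M →ₛₗ[algebraMap R R'] M')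
    (hr_surj : ∀ m' : M', ∃ (n : ℕ) (m : M), r m = algebraMap R R' g ^ n • m')
    (s : Fin d → M') :
    ∃ (N : ℕ) (s₀ : Fin d → M), ∀ j, r (s₀ j) = algebraMap R R' g ^ N • s j := by
  choose n m hm using fun j ↦ hr_surj (s j)
  refine ⟨∑ j, n j, fun j ↦ g ^ (∑ j, n j - n j) • m j, fun j ↦ ?_⟩
  rw [map_smulₛₗ, hm, map_pow, smul_smul, ← pow_add, Nat.sub_add_cancel]
  exact Finset.single_le_sum (fun _ _ ↦ Nat.zero_le _) (Finset.mem_univ j)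


variable {R' : Type u} [CommRing R'] [Algebra R R'] {M' : Type u} [AddCommGroup M'] [Module R' M']
  (g : R) [IsLocalization.Away g R'] (r : M →ₛₗ[algebraMap R R'] M')
  {S' : Finset (Fin d → M')} (h : ∀ s ∈ S, r ∘ s ∈ S')

lemma ChartRing.epi
    (hr_surj : ∀ m' : M', ∃ (n : ℕ) (m : M), r m = algebraMap R R' g ^ n • m')
    (hS : S.Nonempty) {B : Type u} [CommRing B] {α β : ChartRing R' M' S' →+* B}
    (hαβ : α.comp (ChartRing.map (algebraMap R R') r h) =
      β.comp (ChartRing.map (algebraMap R R') r h)) : α = β := by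
  obtain ⟨t, ht⟩ := hS
  let t' : S' := ⟨r ∘ t, h t ht⟩
  have h1 : α.comp (algebraMap R' _) = β.comp (algebraMap R' _) := by
    refine IsLocalization.ringHom_ext (Submonoid.powers g) (RingHom.ext fun a ↦ ?_)
    simpa using congr($hαβ (algebraMap R _ a))
  have h2 (m i) : α (coord t' m i) = β (coord t' m i) := by
    obtain ⟨n, m₀, hm⟩ := hr_surj m
    have := congr($hαβ (coord ⟨t, ht⟩ m₀ i))
    simp only [RingHom.comp_apply, map_coord, hm, coord_smul, map_mul] at this
    have e := congr($h1 (algebraMap R R' g ^ n))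
    simp only [RingHom.comp_apply] at e
    rw [← e] at this
    refine IsUnit.mul_left_cancel ?_ this
    exact (((IsLocalization.Away.algebraMap_isUnit g).pow n).map (algebraMap R' _)).map α
  refine ChartRing.hom_ext (fun a ↦ congr($h1 a)) fun s m i ↦ ?_
  have h3 : (mat (coord s) t'.1).map α = (mat (coord s) t'.1).map β := by
    have ha := congr(($(mat_mul_mat (R := R') t' s)).map α)
    have hb := congr(($(mat_mul_mat (R := R') s t')).map β)
    have e : (mat (coord t') s.1).map α = (mat (coord t') s.1).map β := by
      ext a b; exact h2 _ _
    rw [Matrix.map_mul, Matrix.map_one _ (map_zero _) (map_one _)] at ha hb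
    rw [← e] at hb
    exact (left_inv_eq_right_inv hb ha).symm
  rw [coord_change t' s m i, map_sum, map_sum]
  refine Finset.sum_congr rfl fun j _ ↦ ?_
  rw [map_mul, map_mul, h2]
  congr 1
  exact congr($h3 j i)

lemma ChartRing.exists_extension {t : Fin d → M} (ht : t ∈ S) {B : Type u} [CommRing B]
    (ρ : ChartRing R M S →+* B) (ψ : R' →+* B) (hψ : ∀ a, ψ (algebraMap R R' a) = ρ (algebraMap R _ a))
    (c : M' → Fin d → B) (hc_add : ∀ m n, c (m + n) = c m + c n)
    (hc_smul : ∀ a m i, c (a • m) i = ψ a * c m i) 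
    (hc : ∀ m i, c (r m) i = ρ (coord ⟨t, ht⟩ m i))
    (hu : ∀ s ∈ S', IsUnit (mat c s)) :
    ∃ α : ChartRing R' M' S' →+* B, α.comp (ChartRing.map (algebraMap R R') r h) = ρ := by
  let c' (s : S') (m : M') : Fin d → B := Matrix.vecMul (c m) (mat c s.1)⁻¹
  have h_self (s : S') j : c' s (s.1 j) = Pi.single j 1 := by
    have e : (mat c s.1) * (mat c s.1)⁻¹ = 1 :=
      Matrix.mul_nonsing_inv _ ((Matrix.isUnit_iff_isUnit_det _).mp (hu s.1 s.2))
    ext i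
    have := congr($e j i)
    rw [Matrix.mul_apply, Matrix.one_apply] at this
    rw [Pi.single_apply]
    simpa [c', Matrix.vecMul, dotProduct, mat, eq_comm] using this
  have h_add (s : S') m n : c' s (m + n) = c' s m + c' s n := by
    simp [c', hc_add, Matrix.add_vecMul]
  have h_smul (s : S') a m : c' s (a • m) = ψ a • c' s m := by
    have : c (a • m) = ψ a • c m := by ext i; simp [hc_smul]
    simp [c', this, Matrix.smul_vecMul]
  have h_c (s : S') m : c m = Matrix.vecMul (c' s m) (mat c s.1) := by
    simp only [c', Matrix.vecMul_vecMul]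
    rw [Matrix.nonsing_inv_mul _ ((Matrix.isUnit_iff_isUnit_det _).mp (hu s.1 s.2)),
      Matrix.vecMul_one]
  have h_change' (s t : S') m : c' t m = Matrix.vecMul (c' s m) (mat (c' t) s.1) := by
    have e : mat (c' t) s.1 = mat c s.1 * (mat c t.1)⁻¹ := by
      ext a b
      rfl
    rw [e, ← Matrix.vecMul_vecMul, ← h_c]
  have h_change (s t : S') m i : c' t m i = ∑ j, c' s m j * c' t (s.1 j) i :=
    congr($(h_change' s t m) i)
  refine ⟨ChartRing.lift ψ c' (fun s m n i ↦ congr($(h_add s m n) i))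
    (fun s a m i ↦ congr($(h_smul s a m) i))
    (fun s j i ↦ by rw [h_self, Pi.single_apply]; simp [eq_comm]) h_change, ?_⟩
  refine ChartRing.hom_ext (fun a ↦ by simp [hψ]) fun s m i ↦ ?_
  simp only [RingHom.comp_apply, map_coord, lift_coord]
  have key : c (r m) = Matrix.vecMul (fun i ↦ ρ (coord s m i)) (mat c (r ∘ s.1)) := by
    ext b
    rw [hc, coord_change s ⟨t, ht⟩, map_sum]
    refine Finset.sum_congr rfl fun j _ ↦ ?_
    simp [mat, hc]
  have := hu _ (h s.1 s.2)
  simp only [c']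
  rw [key, Matrix.vecMul_vecMul,
    Matrix.mul_nonsing_inv _ ((Matrix.isUnit_iff_isUnit_det _).mp this), Matrix.vecMul_one]

lemma exists_extend_coord
    (hr_surj : ∀ m' : M', ∃ (n : ℕ) (m : M), r m = algebraMap R R' g ^ n • m')
    (hr_inj : ∀ m : M, r m = 0 → ∃ n : ℕ, g ^ n • m = 0)
    (t : S) {B : Type u} [CommRing B]
    (ρ : ChartRing R M S →+* B) (ψ : R' →+* B)
    (hψ : ∀ a, ψ (algebraMap R R' a) = ρ (algebraMap R _ a)) :
    ∃ c : M' → Fin d → B, (∀ m n, c (m + n) = c m + c n) ∧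
      (∀ a m i, c (a • m) i = ψ a * c m i) ∧ ∀ m i, c (r m) i = ρ (coord t m i) := by
  have hu : IsUnit (ψ (algebraMap R R' g)) := (IsLocalization.Away.algebraMap_isUnit g).map ψ
  choose n₀ m₀ hm₀ using hr_surj
  obtain ⟨u, hu⟩ := hu
  let c (m : M') (i : Fin d) : B := (u⁻¹ : Bˣ) ^ n₀ m * ρ (coord t (m₀ m) i)
  have c_spec (m' : M') (n : ℕ) (m : M) (e : r m = algebraMap R R' g ^ n • m') (i : Fin d) :
      (u : B) ^ n * c m' i = ρ (coord t m i) := by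
    have h0 : r (g ^ n • m₀ m' - g ^ n₀ m' • m) = 0 := by
      rw [map_sub, map_smulₛₗ, map_smulₛₗ, e, hm₀, map_pow, map_pow, smul_smul, smul_smul,
        mul_comm, sub_self]
    obtain ⟨k, hk⟩ := hr_inj _ h0
    rw [smul_sub, sub_eq_zero, smul_smul, smul_smul] at hk
    have := congr(ρ (coord t $hk i))
    simp only [coord_smul, map_mul, map_pow, ← hψ, ← hu] at this
    rw [mul_assoc, mul_assoc] at this
    have := (u.isUnit.pow k).mul_left_cancel this
    simp only [c]
    have e2 : (u : B) ^ n₀ m' * ((u⁻¹ : Bˣ) : B) ^ n₀ m' = 1 := by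
      rw [← mul_pow, Units.mul_inv, one_pow]
    apply (u.isUnit.pow (n₀ m')).mul_left_cancel
    rw [← this]
    linear_combination (u ^ n * ρ (coord t (m₀ m') i)) * e2
  have c_spec' (m' : M') (i : Fin d) : (u : B) ^ n₀ m' * c m' i = ρ (coord t (m₀ m') i) :=
    c_spec _ _ _ (hm₀ m') i
  refine ⟨c, fun m n ↦ ?_, fun a m i ↦ ?_, fun m i ↦ ?_⟩
  · ext i
    apply (u.isUnit.pow (n₀ m + n₀ n)).mul_left_cancel
    rw [c_spec (m + n) (n₀ m + n₀ n) (g ^ n₀ n • m₀ m + g ^ n₀ m • m₀ n), coord_add, coord_smul,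
      coord_smul]
    · simp only [map_add, map_mul, map_pow, ← hψ, ← hu, ← c_spec', Pi.add_apply]
      ring
    · simp only [map_add, map_smulₛₗ, hm₀, map_pow, smul_smul, smul_add, pow_add]
      rw [mul_comm]
  · obtain ⟨⟨b, _, k, rfl⟩, hb⟩ := IsLocalization.surj (Submonoid.powers g) a
    have hb' : a * algebraMap R R' g ^ k = algebraMap R R' b := by simpa using hb
    apply (u.isUnit.pow (k + n₀ m)).mul_left_cancel
    rw [c_spec (a • m) (k + n₀ m) (b • m₀ m), coord_smul, map_mul, ← hψ, ← hb', ← c_spec']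
    · simp only [map_mul, map_pow, ← hu]
      ring
    · rw [map_smulₛₗ, hm₀, ← hb', smul_smul, smul_smul]
      congr 1
      ring
  · have := c_spec (r m) 0 m (by simp) i
    simpa using this

lemma ChartRing.exists_isLocalization_away
    (hr_surj : ∀ m' : M', ∃ (n : ℕ) (m : M), r m = algebraMap R R' g ^ n • m')
    (hr_inj : ∀ m : M, r m = 0 → ∃ n : ℕ, g ^ n • m = 0)
    (hS : S.Nonempty) :
    ∃ a : ChartRing R M S, letI := (ChartRing.map (algebraMap R R') r h).toAlgebra
      IsLocalization.Away a (ChartRing R' M' S') := by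
  have hS' := hS
  obtain ⟨t, ht⟩ := hS'
  choose N l hl using fun s : Fin d → M' ↦ exists_lift g r hr_surj s
  let a : ChartRing R M S :=
    algebraMap R _ g * ∏ s ∈ S', (mat (coord ⟨t, ht⟩) (l s)).det
  let θ := ChartRing.map (algebraMap R R') r h
  have hg : IsUnit (algebraMap R' (ChartRing R' M' S') (algebraMap R R' g)) :=
    (IsLocalization.Away.algebraMap_isUnit g).map _
  have ha : IsUnit (θ a) := by
    simp only [a, map_mul, map_prod, θ, ChartRing.map_algebraMap]
    refine hg.mul ?_
    refine (Submonoid.prod_mem (IsUnit.submonoid _) fun s hs ↦ ?_)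
    change IsUnit _
    rw [RingHom.map_det]
    let t' : S' := ⟨r ∘ t, h t ht⟩
    have e : θ.mapMatrix (mat (coord ⟨t, ht⟩) (l s)) =
        (algebraMap R' (ChartRing R' M' S') (algebraMap R R' g)) ^ N s •
          mat (coord (R := R') t') s := by
      ext j i
      simp [mat, θ, hl, coord_smul, t']
    change IsUnit (θ.mapMatrix (mat (coord ⟨t, ht⟩) (l s))).det
    rw [e, Matrix.det_smul]
    refine ((hg.pow _).pow _).mul ?_
    exact (Matrix.isUnit_iff_isUnit_det _).mp
      (IsUnit.of_mul_eq_one _ (mat_mul_mat (R := R') t' ⟨s, hs⟩))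
  refine ⟨a, ?_⟩
  let : Algebra (ChartRing R M S) (ChartRing R' M' S') := θ.toAlgebra
  let ρ := algebraMap (ChartRing R M S) (Localization.Away a)
  have hρ : IsUnit (ρ a) := IsLocalization.Away.algebraMap_isUnit a
  have hρ' : IsUnit (ρ (algebraMap R _ g)) := by
    simp only [a, map_mul] at hρ
    exact isUnit_of_mul_isUnit_left hρ
  let ψ : R' →+* Localization.Away a := IsLocalization.Away.lift g (g := ρ.comp (algebraMap R _)) hρ'
  have hψ (b) : ψ (algebraMap R R' b) = ρ (algebraMap R _ b) := IsLocalization.Away.lift_eq g hρ' b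
  obtain ⟨c, hc_add, hc_smul, hc⟩ := exists_extend_coord g r hr_surj hr_inj ⟨t, ht⟩ ρ ψ hψ
  obtain ⟨α, hα⟩ := ChartRing.exists_extension (S' := S') r h ht ρ ψ hψ c hc_add hc_smul hc (by
    intro s hs
    have h1 : IsUnit (ρ (mat (coord ⟨t, ht⟩) (l s)).det) := by
      simp only [a, map_mul, map_prod] at hρ
      exact isUnit_of_dvd_unit
        (Finset.dvd_prod_of_mem (fun s ↦ ρ (mat (coord ⟨t, ht⟩) (l s)).det) hs) (isUnit_of_mul_isUnit_right hρ)
    have e : ρ.mapMatrix (mat (coord ⟨t, ht⟩) (l s)) =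
        (ψ (algebraMap R R' g)) ^ N s • mat c s := by
      ext j i
      simp [mat, ← hc, hl, hc_smul]
    rw [RingHom.map_det, e, Matrix.det_smul] at h1
    exact (Matrix.isUnit_iff_isUnit_det _).mpr (isUnit_of_mul_isUnit_right h1))
  let β : Localization.Away a →+* ChartRing R' M' S' := IsLocalization.Away.lift a (g := θ) ha
  have hβ : β.comp ρ = θ := IsLocalization.Away.lift_comp a ha
  have h1 : β.comp α = RingHom.id _ := by
    refine ChartRing.epi g r h hr_surj hS ?_
    rw [RingHom.comp_assoc, hα, hβ]
    rfl
  have h2 : α.comp β = RingHom.id _ := by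
    refine IsLocalization.ringHom_ext (Submonoid.powers a) ?_
    rw [RingHom.comp_assoc]
    change α.comp (β.comp ρ) = _
    rw [hβ, hα]
    rfl
  refine IsLocalization.isLocalization_of_algEquiv (S := Localization.Away a) _
    (AlgEquiv.ofRingEquiv (f := RingEquiv.ofRingHom β α h1 h2) fun x ↦ congr($hβ x))

end localization

end ChartRing

/-! ### The relative Grassmannian of a quasi-coherent module -/

section Grassmannian

variable {X : Scheme.{u}}

/-- Restriction of functions from an affine open `V` to a basic affine open `U` of it. -/
abbrev restr {U V : X.AffineZariskiSite} (h : U ≤ V) : Γ(X, V.toOpens) →+* Γ(X, U.toOpens) :=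
  (X.presheaf.map (homOfLE (Scheme.AffineZariskiSite.toOpens_mono h)).op).hom

lemma restr_refl {U : X.AffineZariskiSite} (a : Γ(X, U.toOpens)) : restr (le_refl U) a = a :=
  congr($(X.presheaf.map_id _).hom a)

lemma restr_restr {U V W : X.AffineZariskiSite} (h : U ≤ V) (h' : V ≤ W) (a : Γ(X, W.toOpens)) :
    restr h (restr h' a) = restr (h.trans h') a := by
  simp only [restr]
  rw [← CommRingCat.comp_apply, ← X.presheaf.map_comp]
  rfl

/-- A quasi-coherent `𝒪_X`-module, given by its sections over the affine opens of `X` and the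
restrictions to basic opens: a `Γ(X, U)`-module for each affine open `U`, such that restriction to
`D(g) ⊆ U` is localization at `g`. Here `U ≤ V` for affine opens means that `U` is a basic open of
`V`. -/
structure QCohModule (X : Scheme.{u}) where
  sec : X.AffineZariskiSite → Type u
  [addCommGroup : ∀ U, AddCommGroup (sec U)]
  [module : ∀ U, Module Γ(X, U.toOpens) (sec U)]
  res : ∀ {U V : X.AffineZariskiSite} (h : U ≤ V),
    sec V →ₛₗ[restr h] sec U
  res_refl : ∀ (U : X.AffineZariskiSite) (m : sec U), res (le_refl U) m = m
  res_res : ∀ {U V W : X.AffineZariskiSite} (h : U ≤ V) (h' : V ≤ W) (m : sec W),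
    res h (res h' m) = res (h.trans h') m
  exists_res_eq : ∀ (U : X.AffineZariskiSite) (g : Γ(X, U.toOpens)) (m' : sec (U.basicOpen g)),
    ∃ (n : ℕ) (m : sec U), res (U.basicOpen_le g) m =
      restr (U.basicOpen_le g) g ^ n • m'
  exists_pow_smul_eq_zero : ∀ (U : X.AffineZariskiSite) (g : Γ(X, U.toOpens)) (m : sec U),
    res (U.basicOpen_le g) m = 0 → ∃ n : ℕ, g ^ n • m = 0

attribute [instance] QCohModule.addCommGroup QCohModule.module

variable (F : QCohModule X) (d : ℕ)

/-- The charts of the Grassmannian of rank `d` quotients of `F` are indexed by an affine open `U` of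
`X` and a nonempty finite set `S` of `d`-tuples of sections of `F` over `U`. -/
structure ChartIndex where
  U : X.AffineZariskiSite
  S : Finset (Fin d → F.sec U)
  nonempty : S.Nonempty

variable {F d}

/-- `(U, S) ≤ (V, T)` if `U` is a basic open of `V` and `S` contains the restrictions of all tuples
in `T`: the chart of `(U, S)` is then an open subset of the chart of `(V, T)`. -/
instance : Preorder (ChartIndex F d) where
  le i j := ∃ h : i.U ≤ j.U, ∀ s ∈ j.S, F.res h ∘ s ∈ i.S
  le_refl i := ⟨le_refl _, fun s hs ↦ by
    rwa [show F.res (le_refl i.U) ∘ s = s from funext fun _ ↦ F.res_refl _ _]⟩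
  le_trans i j l := fun ⟨h, H⟩ ⟨h', H'⟩ ↦ ⟨h.trans h', fun s hs ↦ by
    rw [show F.res (h.trans h') ∘ s = F.res h ∘ (F.res h' ∘ s) from
      funext fun _ ↦ (F.res_res _ _ _).symm]
    exact H _ (H' _ hs)⟩

/-- The coordinate ring of a chart. -/
abbrev ChartIndex.ring (i : ChartIndex F d) : Type u :=
  ChartRing Γ(X, i.U.toOpens) (F.sec i.U) i.S

/-- The restriction homomorphism between coordinate rings of charts. -/
def ChartIndex.transition {i j : ChartIndex F d} (h : i ≤ j) : j.ring →+* i.ring :=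
  ChartRing.map _ (F.res h.1) h.2

variable (F d)

variable {F d} in
/-- The inclusion of a smaller chart into a larger one. -/
def chartMap {i j : ChartIndex F d} (h : i ≤ j) : Spec (.of i.ring) ⟶ Spec (.of j.ring) :=
  Spec.map (CommRingCat.ofHom (ChartIndex.transition h))

/-- The diagram of all charts and their inclusions. -/
def chartDiagram : ChartIndex F d ⥤ Scheme.{u} where
  obj i := Spec (.of i.ring)
  map f := chartMap f.le
  map_id i := by
    rw [chartMap]
    rw [← Spec.map_id]
    congr 1
    ext1
    refine ChartRing.hom_ext (fun a ↦ ?_) fun s m a ↦ ?_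
    · simp [ChartIndex.transition, restr_refl]
    · simp [ChartIndex.transition, F.res_refl]
      congr
      ext
      simp [F.res_refl]
  map_comp {i j l} f g := by
    rw [chartMap, chartMap, chartMap]
    rw [← Spec.map_comp]
    congr 1
    ext1
    refine ChartRing.hom_ext (fun a ↦ ?_) fun s m a ↦ ?_
    · simp only [ChartIndex.transition, CommRingCat.hom_ofHom, CommRingCat.hom_comp,
        RingHom.comp_apply, ChartRing.map_algebraMap]
      rw [restr_restr]
    · simp only [ChartIndex.transition, CommRingCat.hom_ofHom, CommRingCat.hom_comp,
        RingHom.comp_apply, ChartRing.map_coord, F.res_res]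
      congr 1
      ext
      simp [F.res_res]

variable {F d}

lemma isUnit_restr {U V : X.AffineZariskiSite} (h : U ≤ V) (g : Γ(X, V.toOpens))
    (hg : X.basicOpen g = U.toOpens) : IsUnit (restr h g) := by
  obtain rfl : V.basicOpen g = U := Subtype.ext hg
  exact RingedSpace.isUnit_res_basicOpen _ g

lemma ChartIndex.exists_isLocalization_away {i j : ChartIndex F d} (h : i ≤ j) :
    ∃ a : j.ring, letI := (ChartIndex.transition h).toAlgebra
      IsLocalization.Away a i.ring := by
  obtain ⟨U, S, hS⟩ := i
  obtain ⟨V, T, hT⟩ := j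
  obtain ⟨⟨g, hg⟩, H⟩ := h
  obtain rfl : V.basicOpen g = U := Subtype.ext hg
  let : Algebra Γ(X, V.toOpens) Γ(X, (V.basicOpen g).toOpens) := (restr (V.basicOpen_le g)).toAlgebra
  have : IsLocalization.Away g Γ(X, (V.basicOpen g).toOpens) := V.2.isLocalization_basicOpen g
  exact ChartRing.exists_isLocalization_away g (F.res (V.basicOpen_le g)) H
    (F.exists_res_eq V g) (F.exists_pow_smul_eq_zero V g) hT

/-- The inclusions of charts are open immersions. -/
instance {i j : ChartIndex F d} (h : i ≤ j) : IsOpenImmersion (chartMap h) := by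
  obtain ⟨a, ha⟩ := ChartIndex.exists_isLocalization_away h
  let := (ChartIndex.transition h).toAlgebra
  exact IsOpenImmersion.of_isLocalization (S := i.ring) a

instance {i j : ChartIndex F d} (f : i ⟶ j) : IsOpenImmersion ((chartDiagram F d).map f) :=
  inferInstanceAs (IsOpenImmersion (chartMap f.le))

lemma chartMap_comp {i j l : ChartIndex F d} (h : i ≤ j) (h' : j ≤ l) :
    chartMap h ≫ chartMap h' = chartMap (h.trans h') :=
  ((chartDiagram F d).map_comp h.hom h'.hom).symm

lemma coord_res_eq {i k : ChartIndex F d} (h : i ≤ k) {W : X.AffineZariskiSite} (hW : W ≤ i.U)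
    {B : Type u} [CommRing B] (α : i.ring →+* B) (ψ : Γ(X, W.toOpens) →+* B)
    (hψ : ∀ a, ψ (restr (hW.trans h.1) a) = α (algebraMap _ _ (restr h.1 a)))
    (t : k.S) (c : F.sec W → Fin d → B)
    (hc_smul : ∀ a m i, c (a • m) i = ψ a * c m i)
    (hc : ∀ m a, c (F.res (hW.trans h.1) m) a = α (ChartIndex.transition h (coord t m a)))
    (m : F.sec i.U) (a : Fin d) :
    c (F.res hW m) a = α (coord ⟨F.res h.1 ∘ t.1, h.2 _ t.2⟩ m a) := by
  obtain ⟨U, S, hS⟩ := i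
  obtain ⟨V, T, hT⟩ := k
  obtain ⟨⟨g, hg⟩, H⟩ := h
  obtain rfl : V.basicOpen g = U := Subtype.ext hg
  obtain ⟨n, m₀, hm⟩ := F.exists_res_eq V g m
  have := hc m₀ a
  simp only [ChartIndex.transition, ChartRing.map_coord] at this
  rw [← F.res_res hW (V.basicOpen_le g), hm, map_smulₛₗ, hc_smul, coord_smul, map_mul, map_pow,
    map_pow, map_pow, map_pow, restr_restr, hψ] at this
  exact (((isUnit_restr (V.basicOpen_le g) g rfl).map (algebraMap _ _)).map α).pow n
    |>.mul_left_cancel this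

lemma ChartIndex.exists_common {i j k : ChartIndex F d} (hi : i ≤ k) (hj : j ≤ k)
    {B : Type u} [CommRing B] (α : i.ring →+* B) (β : j.ring →+* B)
    (h : α.comp (transition hi) = β.comp (transition hj)) :
    ∃ (l : ChartIndex F d) (hli : l ≤ i) (_ : l ≤ j) (γ : l.ring →+* B),
      γ.comp (transition (hli.trans hi)) = α.comp (transition hi) := by
  classical
  obtain ⟨g, hg⟩ := hi.1
  obtain ⟨g', hg'⟩ := hj.1
  obtain ⟨t, ht⟩ := k.nonempty
  let W := k.U.basicOpen (g * g')
  have hWi : W ≤ i.U := ⟨restr hi.1 g', by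
    change X.basicOpen (X.presheaf.map _ g') = X.basicOpen (g * g')
    rw [X.basicOpen_res, X.basicOpen_mul, hg]⟩
  have hWj : W ≤ j.U := ⟨restr hj.1 g, by
    change X.basicOpen (X.presheaf.map _ g) = X.basicOpen (g * g')
    rw [X.basicOpen_res, X.basicOpen_mul, hg', inf_comm]⟩
  have hWk : W ≤ k.U := hWi.trans hi.1
  let l : ChartIndex F d := ⟨W, i.S.image (F.res hWi ∘ ·) ∪ j.S.image (F.res hWj ∘ ·),
    (i.nonempty.image _).inl⟩
  have hli : l ≤ i := ⟨hWi, fun s hs ↦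
    Finset.mem_union_left _ (Finset.mem_image_of_mem (F.res hWi ∘ ·) hs)⟩
  have hlj : l ≤ j := ⟨hWj, fun s hs ↦
    Finset.mem_union_right _ (Finset.mem_image_of_mem (F.res hWj ∘ ·) hs)⟩
  let ρ := α.comp (transition hi)
  have hρg : IsUnit (ρ (algebraMap _ _ (g * g'))) := by
    rw [map_mul, map_mul]
    refine IsUnit.mul ?_ ?_
    · simp only [ρ, RingHom.comp_apply, transition, ChartRing.map_algebraMap]
      exact ((isUnit_restr hi.1 g hg).map (algebraMap _ _)).map α
    · simp only [ρ, h, RingHom.comp_apply, transition, ChartRing.map_algebraMap]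
      exact ((isUnit_restr hj.1 g' hg').map (algebraMap _ _)).map β
  let : Algebra Γ(X, k.U.toOpens) Γ(X, W.toOpens) := (restr hWk).toAlgebra
  have : IsLocalization.Away (g * g') Γ(X, W.toOpens) := k.U.2.isLocalization_basicOpen (g * g')
  let ψ : Γ(X, W.toOpens) →+* B := IsLocalization.Away.lift (g * g')
    (g := ρ.comp (algebraMap _ k.ring)) hρg
  have hψ (a) : ψ (restr hWk a) = ρ (algebraMap _ _ a) :=
    IsLocalization.Away.lift_eq (g * g') hρg a
  obtain ⟨c, hc_add, hc_smul, hc⟩ := exists_extend_coord (g * g') (F.res hWk)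
    (F.exists_res_eq k.U (g * g')) (F.exists_pow_smul_eq_zero k.U (g * g')) ⟨t, ht⟩ ρ ψ hψ
  obtain ⟨γ, hγ⟩ := ChartRing.exists_extension (S' := l.S) (F.res hWk) (hli.trans hi).2 ht ρ ψ hψ
    c hc_add hc_smul hc (by
    intro s hs
    obtain hs | hs := Finset.mem_union.mp hs
    · obtain ⟨s, hs', rfl⟩ := Finset.mem_image.mp hs
      have e : mat c (F.res hWi ∘ s) =
          α.mapMatrix (mat (coord ⟨F.res hi.1 ∘ t, hi.2 _ ht⟩) s) := by
        ext a b
        refine coord_res_eq hi hWi α ψ (fun a ↦ ?_) ⟨t, ht⟩ c hc_smul hc (s a) b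
        rw [hψ]
        simp [ρ, transition]
      rw [e]
      exact (IsUnit.of_mul_eq_one _ (mat_mul_mat (R := Γ(X, i.U.toOpens)) _ ⟨s, hs'⟩)).map
        α.mapMatrix
    · obtain ⟨s, hs', rfl⟩ := Finset.mem_image.mp hs
      have e : mat c (F.res hWj ∘ s) =
          β.mapMatrix (mat (coord ⟨F.res hj.1 ∘ t, hj.2 _ ht⟩) s) := by
        ext a b
        refine coord_res_eq hj hWj β ψ (fun a ↦ ?_) ⟨t, ht⟩ c hc_smul
          (fun m a ↦ (hc m a).trans congr($h _)) (s a) b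
        rw [hψ]
        simp [ρ, h, transition]
      rw [e]
      exact (IsUnit.of_mul_eq_one _ (mat_mul_mat (R := Γ(X, j.U.toOpens)) _ ⟨s, hs'⟩)).map
        β.mapMatrix)
  exact ⟨l, hli, hlj, γ, hγ⟩

lemma exists_common_point {i j k : ChartIndex F d} (hi : i ≤ k) (hj : j ≤ k)
    (xi : Spec (.of i.ring)) (xj : Spec (.of j.ring)) (hx : chartMap hi xi = chartMap hj xj) :
    ∃ (l : ChartIndex F d) (hli : l ≤ i) (hlj : l ≤ j) (y : Spec (.of l.ring)),
      chartMap hli y = xi ∧ chartMap hlj y = xj := by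
  obtain ⟨z, hzi, hzj⟩ := Scheme.Pullback.exists_preimage_pullback
    (f := chartMap hi) (g := chartMap hj) xi xj hx
  let Z := pullback (chartMap hi) (chartMap hj)
  obtain ⟨α, hα⟩ := Spec.map_surjective (Z.fromSpecResidueField z ≫ pullback.fst _ _)
  obtain ⟨β, hβ⟩ := Spec.map_surjective (Z.fromSpecResidueField z ≫ pullback.snd _ _)
  have h' : Spec.map α ≫ chartMap hi = Spec.map β ≫ chartMap hj := by
    rw [hα, hβ, Category.assoc, Category.assoc, pullback.condition]
  have h : α.hom.comp (ChartIndex.transition hi) = β.hom.comp (ChartIndex.transition hj) := by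
    rw [chartMap, chartMap, ← Spec.map_comp, ← Spec.map_comp] at h'
    exact congr(($(Spec.map_injective h')).hom)
  obtain ⟨l, hli, hlj, γ, hγ⟩ := ChartIndex.exists_common hi hj α.hom β.hom h
  let p : Spec (Z.residueField z) := default
  have hp : Z.fromSpecResidueField z p = z := Scheme.fromSpecResidueField_apply ..
  have e : Spec.map (CommRingCat.ofHom γ) ≫ chartMap (hli.trans hi) = Spec.map α ≫ chartMap hi := by
    rw [chartMap, chartMap, ← Spec.map_comp, ← Spec.map_comp]
    congr 1
    ext1
    exact hγ
  have ei : Spec.map (CommRingCat.ofHom γ) ≫ chartMap hli = Spec.map α := by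
    rw [← cancel_mono (chartMap hi), Category.assoc, chartMap_comp, e]
  have ej : Spec.map (CommRingCat.ofHom γ) ≫ chartMap hlj = Spec.map β := by
    rw [← cancel_mono (chartMap hj), Category.assoc, chartMap_comp, e, h']
  refine ⟨l, hli, hlj, Spec.map (CommRingCat.ofHom γ) p, ?_, ?_⟩
  · rw [← Scheme.Hom.comp_apply, ei, hα, Scheme.Hom.comp_apply, hp, hzi]
  · rw [← Scheme.Hom.comp_apply, ej, hβ, Scheme.Hom.comp_apply, hp, hzj]

instance : (chartDiagram F d ⋙ Scheme.forget).IsLocallyDirected where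
  cond {i j k} fi fj xi xj hx := by
    obtain ⟨l, hli, hlj, y, hy⟩ := exists_common_point fi.le fj.le xi xj hx
    exact ⟨l, hli.hom, hlj.hom, y, hy⟩

variable (F d)

/-- Grothendieck's Grassmannian `Grass_d(F)` of rank `d` locally free quotients of `F`: the scheme
glued from all the charts along their common open subcharts. -/
def grassmannian : Scheme.{u} := colimit (chartDiagram F d)

/-- The structure morphism of the Grassmannian; on the chart `(U, S)` it is
`Spec (chart ring) → Spec Γ(X, U) = U ⊆ X`. -/
def grassmannianToBase : grassmannian F d ⟶ X :=
  colimit.desc (chartDiagram F d)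
    { pt := X
      ι :=
        { app := fun i ↦ Spec.map (CommRingCat.ofHom (algebraMap Γ(X, i.U.toOpens) i.ring)) ≫
            i.U.2.fromSpec
          naturality := fun i j f ↦ by
            have : CommRingCat.ofHom (algebraMap Γ(X, j.U.toOpens) j.ring) ≫
                CommRingCat.ofHom (ChartIndex.transition f.le) =
              CommRingCat.ofHom (restr f.le.1) ≫
                CommRingCat.ofHom (algebraMap Γ(X, i.U.toOpens) i.ring) := by
              ext a
              simp [ChartIndex.transition]
            simp only [chartDiagram, chartMap, Functor.const_obj_obj, Functor.const_obj_map,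
              Category.comp_id]
            rw [← Spec.map_comp_assoc, this, Spec.map_comp_assoc]
            congr 1
            exact j.U.2.map_fromSpec i.U.2 _ } }

end Grassmannian

/-! ### The sheaf of differentials -/

section Differentials

lemma kaehler_induction {k A : Type u} [CommRing k] [CommRing A] [Algebra k A]
    {p : Ω[A⁄k] → Prop} (h0 : p 0) (hadd : ∀ x y, p x → p y → p (x + y))
    (hsmul : ∀ (a : A) x, p x → p (a • x)) (hD : ∀ a, p (KaehlerDifferential.D k A a))
    (x : Ω[A⁄k]) : p x := by
  have hx : x ∈ Submodule.span A (Set.range (KaehlerDifferential.D k A)) := by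
    rw [KaehlerDifferential.span_range_derivation]
    trivial
  induction hx using Submodule.span_induction with
  | mem x hx => obtain ⟨a, rfl⟩ := hx; exact hD a
  | zero => exact h0
  | add x y _ _ hx hy => exact hadd x y hx hy
  | smul a x _ hx => exact hsmul a x hx

/-- The map on Kähler differentials induced by a homomorphism of `k`-algebras. -/
def kaehlerMap {k A B : Type u} [CommRing k] [CommRing A] [CommRing B] [Algebra k A] [Algebra k B]
    (φ : A →+* B) (hφ : ∀ c, φ (algebraMap k A c) = algebraMap k B c) :
    Ω[A⁄k] →ₛₗ[φ] Ω[B⁄k] :=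
  letI := φ.toAlgebra
  haveI : IsScalarTower k A B := .of_algebraMap_eq fun c ↦ (hφ c).symm
  { toFun := KaehlerDifferential.map k k A B
    map_add' := map_add _
    map_smul' := fun a x ↦ by rw [map_smul, ← algebraMap_smul B a]; rfl }

@[simp] lemma kaehlerMap_D {k A B : Type u} [CommRing k] [CommRing A] [CommRing B] [Algebra k A]
    [Algebra k B] (φ : A →+* B) (hφ : ∀ c, φ (algebraMap k A c) = algebraMap k B c) (a : A) :
    kaehlerMap φ hφ (KaehlerDifferential.D k A a) = KaehlerDifferential.D k B (φ a) :=
  letI := φ.toAlgebra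
  haveI : IsScalarTower k A B := .of_algebraMap_eq fun c ↦ (hφ c).symm
  KaehlerDifferential.map_D k k A B a

lemma kaehlerMap_localization {k A B : Type u} [CommRing k] [CommRing A] [CommRing B]
    [Algebra k A] [Algebra k B] (φ : A →+* B)
    (hφ : ∀ c, φ (algebraMap k A c) = algebraMap k B c) (g : A)
    (hg : letI := φ.toAlgebra; IsLocalization.Away g B) :
    (∀ y, ∃ (n : ℕ) (x : Ω[A⁄k]), kaehlerMap φ hφ x = φ g ^ n • y) ∧
      ∀ x, kaehlerMap φ hφ x = 0 → ∃ n : ℕ, g ^ n • x = 0 := by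
  let := φ.toAlgebra
  have : IsScalarTower k A B := .of_algebraMap_eq fun c ↦ (hφ c).symm
  have := hg
  refine ⟨fun y ↦ ?_, fun x hx ↦ ?_⟩
  · obtain ⟨⟨x, ⟨_, n, rfl⟩⟩, h⟩ :=
      IsLocalizedModule.surj (Submonoid.powers g) (KaehlerDifferential.map k k A B) y
    refine ⟨n, x, h.symm.trans ?_⟩
    change (g ^ n) • y = _
    rw [← algebraMap_smul B (g ^ n) y, map_pow]
    rfl
  · obtain ⟨⟨_, n, rfl⟩, h⟩ := (IsLocalizedModule.eq_zero_iff (Submonoid.powers g)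
      (KaehlerDifferential.map k k A B)).mp hx
    exact ⟨n, h⟩

variable {k : Type u} [Field k] {X : Scheme.{u}} (f : X ⟶ Spec (.of k))

/-- For a scheme `f : X ⟶ Spec k` over `k`, the `k`-algebra structure on the functions on an affine
open. -/
abbrev sectionsAlgebra (U : X.AffineZariskiSite) : Algebra k Γ(X, U.toOpens) :=
  ((Scheme.ΓSpecIso (.of k)).inv ≫ f.appLE ⊤ U.toOpens le_top).hom.toAlgebra

lemma restr_sectionsAlgebra {U V : X.AffineZariskiSite} (h : U ≤ V) (c : k) :
    restr h ((sectionsAlgebra f V).algebraMap c) = (sectionsAlgebra f U).algebraMap c := by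
  have := f.appLE_map (U := ⊤) (V := V.toOpens) le_top
    (homOfLE (Scheme.AffineZariskiSite.toOpens_mono h)).op
  exact congr($(this).hom ((Scheme.ΓSpecIso (.of k)).inv.hom c))

/-- The sheaf of differentials `Ω_{X/k}`: on an affine open `U` its sections are the Kähler
differentials of the `k`-algebra `Γ(X, U)`. -/
def differentials : QCohModule X where
  sec U := letI := sectionsAlgebra f U; Ω[Γ(X, U.toOpens)⁄k]
  addCommGroup U := letI := sectionsAlgebra f U; inferInstanceAs (AddCommGroup Ω[Γ(X, U.toOpens)⁄k])
  module U :=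
    letI := sectionsAlgebra f U
    inferInstanceAs (Module Γ(X, U.toOpens) Ω[Γ(X, U.toOpens)⁄k])
  res {U V} h :=
    letI := sectionsAlgebra f U
    letI := sectionsAlgebra f V
    kaehlerMap (restr h) (restr_sectionsAlgebra f h)
  res_refl U m := by
    let := sectionsAlgebra f U
    refine kaehler_induction (p := fun m ↦ kaehlerMap (restr (le_refl U))
      (restr_sectionsAlgebra f (le_refl U)) m = m) (map_zero _) (fun x y hx hy ↦ ?_)
      (fun a x hx ↦ ?_) (fun a ↦ ?_) m
    · rw [map_add, hx, hy]
    · rw [map_smulₛₗ, hx, restr_refl]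
    · rw [kaehlerMap_D, restr_refl]
  res_res {U V W} h h' m := by
    let := sectionsAlgebra f U
    let := sectionsAlgebra f V
    let := sectionsAlgebra f W
    refine kaehler_induction (p := fun m ↦ kaehlerMap (restr h) (restr_sectionsAlgebra f h)
      (kaehlerMap (restr h') (restr_sectionsAlgebra f h') m) =
      kaehlerMap (restr (h.trans h')) (restr_sectionsAlgebra f (h.trans h')) m)
      (by simp only [map_zero]) (fun x y hx hy ↦ ?_) (fun a x hx ↦ ?_) (fun a ↦ ?_) m
    · simp only [map_add, hx, hy]
    · simp only [map_smulₛₗ, hx, restr_restr]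
    · simp only [kaehlerMap_D, restr_restr]
  exists_res_eq U g :=
    letI := sectionsAlgebra f U
    letI := sectionsAlgebra f (U.basicOpen g)
    (kaehlerMap_localization (restr (U.basicOpen_le g))
      (restr_sectionsAlgebra f (U.basicOpen_le g)) g (U.2.isLocalization_basicOpen g)).1
  exists_pow_smul_eq_zero U g :=
    letI := sectionsAlgebra f U
    letI := sectionsAlgebra f (U.basicOpen g)
    (kaehlerMap_localization (restr (U.basicOpen_le g))
      (restr_sectionsAlgebra f (U.basicOpen_le g)) g (U.2.isLocalization_basicOpen g)).2

end Differentials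

/-! ### The Nash modification -/

section Nash

/-- The set of points of `X` whose local ring is regular. -/
def regularLocus (X : Scheme.{u}) : Set X := {x | IsRegularLocalRing (X.presheaf.stalk x)}

/-- `X` is regular if its local ring at each closed point is regular. -/
def IsRegularVariety (X : Scheme.{u}) : Prop := ∀ x : X, IsClosed {x} → x ∈ regularLocus X

/-- The dimension of a variety (the Krull dimension of its underlying space, which is finite and
not `⊥` for a variety). -/
def dim (X : Scheme.{u}) : ℕ := ((topologicalKrullDim X).unbotD 0).toNat

variable {k : Type u} [Field k] {X : Scheme.{u}} (f : X ⟶ Spec (.of k))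

/-- The Nash modification of a variety `X` over `k`, of dimension `d`: the closure, with its reduced
structure, of the regular locus of `X` in the Grassmannian `G = Grass_d(Ω_{X/k})`. Over the regular
locus `Ω_{X/k}` is locally free of rank `d`, hence is its own only quotient of rank `d`; so the
part of `G` over the regular locus is exactly the image of the section `x ↦ (Ω_{X/k} → Ω_{X/k})`
there, and it is this subset of `G` whose closure is taken. -/
def nash : Scheme.{u} :=
  (Scheme.IdealSheafData.vanishingIdeal ⟨closure
    (grassmannianToBase (differentials f) (dim X) ⁻¹' regularLocus X), isClosed_closure⟩).subscheme

/-- The Nash modification as a morphism to `X`. -/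
def nashToBase : nash f ⟶ X :=
  Scheme.IdealSheafData.subschemeι _ ≫ grassmannianToBase (differentials f) (dim X)

end Nash

end NashModification

end

/-! Let `d = dim X`. If `π` is an isomorphism, its inverse followed by the inclusion of the Nash
modification is a section of the Grassmannian. Near a point it amounts to an affine open with ring
`A` and a linear map `c : Ω_A → A^d` with elements `m j` going to the standard basis
(`exists_coord_of_section`). In characteristic zero `Ω_A` has generic rank `d`, so `ker c` is
torsion, and the point is that `Ω_A` has no torsion (`torsion_kaehlerDifferential_eq_bot`). Let `I`
be the annihilator of the torsion. The Lie derivative along a derivation preserves torsion, so every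
derivation preserves `I`, and in characteristic zero also each minimal prime `P` over `I`. If there
were torsion, `I` would be proper and nonzero, and the components of `c ∘ d` would descend to `A/P`,
making `d` elements of `Ω_{A/P}` independent; but its rank is `dim A/P < d`. Hence the `m j`
generate `Ω_A`. At a closed point the cotangent space is a quotient of the localized differentials,
so the embedding dimension is at most `d`, and the local ring is regular.

Conversely, at a regular closed point Nakayama's lemma shows that the differentials of `d`
parameters generate `Ω`, and the rank count makes them a basis nearby
(`exists_basis_differentials`). By quasi-compactness such neighbourhoods cover `X`, so the
Grassmannian is isomorphic to `X` (`isIso_toBase`). It is then reduced, the regular locus is dense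
in it, and the Nash modification is all of it. -/

noncomputable section

namespace NashModification

/-! ### Dimension, heights of maximal ideals and the rank of differentials -/

section Dimension

/-- Induction on the number of variables: a maximal ideal of a polynomial ring over a Jacobson ring
contracts to a maximal ideal, and the height rises by one. -/
lemma height_maximal_mvPolynomial (k : Type*) [Field k] (n : ℕ)
    (m : Ideal (MvPolynomial (Fin n) k)) [m.IsMaximal] : m.height = n := by
  induction n with
  | zero =>
    have e : ringKrullDim (MvPolynomial (Fin 0) k) = 0 := by
      simp [ringKrullDim_eq_zero_of_field]
    have h := Ideal.height_le_ringKrullDim_of_ne_top (I := m) Ideal.IsPrime.ne_top'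
    rw [e] at h
    have : (m.height : ℕ∞) ≤ 0 := by exact_mod_cast h
    simpa using this
  | succ n ih =>
    let e := (MvPolynomial.finSuccEquiv k n).toRingEquiv
    have hm : (m.map e).IsMaximal := Ideal.map_isMaximal_of_equiv e
    have hp : ((m.map e).comap Polynomial.C).IsMaximal :=
      Polynomial.isMaximal_comap_C_of_isJacobsonRing _
    have : (m.map e).LiesOver ((m.map e).comap Polynomial.C) := ⟨rfl⟩
    have h := Polynomial.height_eq_height_add_one ((m.map e).comap Polynomial.C) (m.map e)
    rw [ih, e.height_map] at h
    rw [h]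
    push_cast
    rfl

lemma finrank_kaehlerDifferential_fractionRing (k A K : Type*) [CommRing k] [CommRing A]
    [IsDomain A] [Algebra k A] [Field K] [Algebra A K] [IsFractionRing A K] [Algebra k K]
    [IsScalarTower k A K] : Module.finrank K Ω[K⁄k] = Module.finrank A Ω[A⁄k] := by
  rw [← IsLocalizedModule.finrank_eq (nonZeroDivisors A) (KaehlerDifferential.map k k A K) le_rfl]
  exact IsFractionRing.finrank_right_eq (R := A) (S := K) _

/-- The extension `K/L` of fraction fields is algebraic and, in characteristic zero, separable. It
is therefore formally étale, and `Ω[K⁄k]` is the base change of `Ω[L⁄k]`. -/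
lemma finrank_kaehlerDifferential_eq_of_isFractionRing (k P A L K : Type*) [CommRing k]
    [CommRing P] [IsDomain P] [CommRing A] [IsDomain A] [Algebra k P] [Algebra k A] [Algebra P A] [IsScalarTower k P A]
    [FaithfulSMul P A] [Algebra.IsIntegral P A] [Field L] [CharZero L] [Algebra P L]
    [IsFractionRing P L] [Field K] [Algebra A K] [IsFractionRing A K] [Algebra k L]
    [IsScalarTower k P L] [Algebra k K] [IsScalarTower k A K] [Algebra P K] [IsScalarTower P A K]
    [Algebra L K] [IsScalarTower P L K] :
    Module.finrank A Ω[A⁄k] = Module.finrank P Ω[P⁄k] := by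
  have : IsScalarTower k P K := .to₁₂₄ k P A K
  have : IsScalarTower k L K := .of_algebraMap_eq fun x ↦ by
    rw [IsScalarTower.algebraMap_apply k P K, IsScalarTower.algebraMap_apply k P L,
      ← IsScalarTower.algebraMap_apply P L K]
  have : Algebra.IsAlgebraic P A := inferInstance
  have : Algebra.IsAlgebraic A K := IsLocalization.isAlgebraic (R := A) K (nonZeroDivisors A)
  have : Algebra.IsAlgebraic P K := .trans P A K
  have : Algebra.IsAlgebraic L K := (IsFractionRing.comap_isAlgebraic_iff (A := P) (K := L)
    (C := K)).mp inferInstance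
  have : Algebra.FormallyEtale L K := Algebra.FormallyEtale.of_isSeparable L K
  have e := KaehlerDifferential.tensorKaehlerEquivOfFormallyEtale k L K
  rw [← finrank_kaehlerDifferential_fractionRing k A K, ← e.finrank_eq, Module.finrank_baseChange,
    finrank_kaehlerDifferential_fractionRing k P L]

lemma finrank_kaehlerDifferential_eq (k P A : Type*) [Field k] [CharZero k] [CommRing P] [IsDomain P]
    [CommRing A] [IsDomain A] [Algebra k P] [Algebra k A] [Algebra P A] [IsScalarTower k P A]
    [FaithfulSMul P A] [Algebra.IsIntegral P A] :
    Module.finrank A Ω[A⁄k] = Module.finrank P Ω[P⁄k] := by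
  have : FaithfulSMul P (FractionRing A) := .trans P A _
  let := FractionRing.liftAlgebra P (FractionRing A)
  have : CharZero (FractionRing P) :=
    charZero_of_injective_algebraMap (algebraMap k (FractionRing P)).injective
  exact finrank_kaehlerDifferential_eq_of_isFractionRing k P A (FractionRing P) (FractionRing A)

variable (k A : Type u) [Field k] [CharZero k] [CommRing A] [IsDomain A] [Algebra k A]
  [Algebra.FiniteType k A]

/-- Noether normalization: `A` is finite over a polynomial ring `P` in `n` variables, where all
three numbers are known, and each of them transfers to `A`. -/
theorem exists_dimension : ∃ n : ℕ, ringKrullDim A = n ∧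
    (∀ m : Ideal A, m.IsMaximal → m.height = n) ∧ Module.finrank A Ω[A⁄k] = n := by
  obtain ⟨n, g, hg, hfin⟩ := exists_finite_inj_algHom_of_fg k A
  let P := MvPolynomial (Fin n) k
  let : Algebra P A := g.toRingHom.toAlgebra
  have : IsScalarTower k P A := .of_algebraMap_eq fun c ↦ (g.commutes c).symm
  have : Module.Finite P A := hfin
  have : IsNoetherianRing A := Algebra.FiniteType.isNoetherianRing k A
  have hinj : Function.Injective (algebraMap P A) := hg
  have : FaithfulSMul P A := (faithfulSMul_iff_algebraMap_injective P A).mpr hinj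
  have hdim : ∀ m : Ideal A, m.IsMaximal → (n : ℕ∞) ≤ m.height := fun m hm ↦ by
    have := Ideal.isMaximal_comap_of_isIntegral_of_isMaximal (R := P) m
    -- Going-down bounds the height of `m` from below by that of its contraction, which is maximal
    -- in `P`.
    have h := Ideal.height_eq_height_add_of_liesOver_of_hasGoingDown (m.under P) m
    have h2 := height_maximal_mvPolynomial k n (m.under P)
    rw [h, h2]
    exact le_self_add
  have hle : ringKrullDim A ≤ n := by
    have h1 : ringKrullDim P = n := by simp [P, ringKrullDim_eq_zero_of_field]
    rw [← h1]
    -- Incomparability: contraction along an integral extension is strictly monotone on primes.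
    exact Order.krullDim_le_of_strictMono (PrimeSpectrum.comap (algebraMap P A))
      fun p q h ↦ Ideal.IsIntegral.comap_lt_comap h
  have hle' (m : Ideal A) (hm : m.IsMaximal) : m.height ≤ n := by
    have := (Ideal.height_le_ringKrullDim_of_ne_top (I := m) Ideal.IsPrime.ne_top').trans hle
    exact_mod_cast this
  refine ⟨n, le_antisymm hle ?_, fun m hm ↦ le_antisymm (hle' m hm) (hdim m hm), ?_⟩
  · obtain ⟨m, hm⟩ := Ideal.exists_maximal A
    have := Ideal.height_le_ringKrullDim_of_ne_top (I := m) Ideal.IsPrime.ne_top'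
    exact le_trans (by exact_mod_cast hdim m hm) this
  · exact (finrank_kaehlerDifferential_eq k P A).trans (by
      rw [Module.finrank_eq_card_basis (KaehlerDifferential.mvPolynomialBasis k (Fin n))]
      simp)

end Dimension

/-! ### Ideals preserved by derivations -/

section Derivations

/-- If `a ∈ P` but `D a ∉ P`, then `F` misses the multiplicative set generated by `a` and the
complement of `P`. A prime containing `F` and avoiding that set would lie strictly inside `P`,
against minimality. -/
lemma derivation_mem_of_mem_minimalPrimes {k A : Type*} [Field k] [CharZero k] [CommRing A]
    [Algebra k A] (D : Derivation k A A) {F P : Ideal A} (hF : ∀ a ∈ F, D a ∈ F)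
    (hP : P ∈ F.minimalPrimes) {a : A} (ha : a ∈ P) : D a ∈ P := by
  have hprime : P.IsPrime := hP.1.1
  by_contra hDa
  have key (m : ℕ) : ∀ u ∉ P, u * a ^ m ∉ F := by
    induction m with
    | zero => exact fun u hu h ↦ hu (hP.1.2 (by simpa using h))
    | succ m ih =>
      intro u hu h
      refine ih (u ^ 2 * D a) (fun h' ↦ ?_) ?_
      · obtain h' | h' := hprime.mem_or_mem h'
        · exact hu (hprime.mem_of_pow_mem _ h')
        · exact hDa h'
      -- This element equals `(m + 1) * u ^ 2 * a ^ m * D a`; the factor `m + 1` is invertible in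
      -- characteristic zero.
      · have h1 : u * D (u * a ^ (m + 1)) - D u * (u * a ^ (m + 1)) ∈ F :=
          F.sub_mem (F.mul_mem_left _ (hF _ h)) (F.mul_mem_left _ h)
        have h2 := F.mul_mem_left (algebraMap k A ((m + 1 : ℕ) : k)⁻¹) h1
        convert h2 using 1
        have h3 : algebraMap k A ((m + 1 : ℕ) : k)⁻¹ * ((m + 1 : ℕ) : A) = 1 := by
          rw [← map_natCast (algebraMap k A), ← map_mul,
            inv_mul_cancel₀ (Nat.cast_ne_zero.mpr m.succ_ne_zero), map_one]
        rw [D.leibniz, D.leibniz_pow]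
        simp only [smul_eq_mul, nsmul_eq_mul, Nat.add_sub_cancel]
        linear_combination (-(u ^ 2 * a ^ m * D a)) * h3
  have hdisj : Disjoint (F : Set A) (P.primeCompl ⊔ Submonoid.powers a : Submonoid A) := by
    rw [Set.disjoint_left]
    intro x hx hx'
    obtain ⟨u, hu, _, ⟨m, rfl⟩, rfl⟩ := Submonoid.mem_sup.mp hx'
    exact key m u hu hx
  obtain ⟨Q, hQ, hFQ, hQd⟩ := Ideal.exists_le_prime_disjoint F _ hdisj
  have hQP : Q ≤ P := fun x hx ↦ by
    by_contra hxP
    exact Set.disjoint_left.mp hQd hx (Submonoid.mem_sup_left (show x ∈ P.primeCompl from hxP))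
  exact Set.disjoint_left.mp hQd (hP.2 ⟨hQ, hFQ⟩ hQP ha)
    (Submonoid.mem_sup_right (Submonoid.mem_powers a))

variable {k A : Type u} [CommRing k] [CommRing A] [Algebra k A]

/-- The product `M × M`, on which `a` acts by `(x, y) ↦ (a x, a y + D a x)`. -/
def DualModule (_ : Derivation k A A) (M : Type*) := M × M

namespace DualModule

variable (D : Derivation k A A) (M : Type*) [AddCommGroup M]

instance : AddCommGroup (DualModule D M) := inferInstanceAs (AddCommGroup (M × M))

variable {D M} in
/-- The element of the twisted product with given components. -/
def mk (x y : M) : DualModule D M := (x, y)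

/-- The first component. -/
def fst : DualModule D M →+ M := AddMonoidHom.fst M M

/-- The second component. -/
def snd : DualModule D M →+ M := AddMonoidHom.snd M M

variable {M} in
@[simp] lemma fst_mk (x y : M) : fst D M (mk x y) = x := rfl

variable {M} in
@[simp] lemma snd_mk (x y : M) : snd D M (mk x y) = y := rfl

variable {D M} in
lemma ext {x y : DualModule D M} (h : fst D M x = fst D M y) (h' : snd D M x = snd D M y) :
    x = y := Prod.ext h h'

variable [Module A M]

instance : SMul A (DualModule D M) where
  smul a x := mk (a • fst D M x) (a • snd D M x + D a • fst D M x)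

@[simp] lemma fst_smul (a : A) (x : DualModule D M) : fst D M (a • x) = a • fst D M x := rfl

@[simp] lemma snd_smul (a : A) (x : DualModule D M) :
    snd D M (a • x) = a • snd D M x + D a • fst D M x := rfl

instance : Module A (DualModule D M) where
  one_smul x := ext (by simp) (by simp)
  mul_smul a b x := ext (by simp [mul_smul]) (by
    simp only [snd_smul, fst_smul, D.leibniz, smul_add, add_smul, smul_eq_mul, smul_smul,
      mul_comm b]
    abel)
  smul_zero a := ext (by simp) (by simp)
  smul_add a x y := ext (by simp) (by simp only [snd_smul, map_add, smul_add]; abel)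
  add_smul a b x := ext (by simp [add_smul]) (by
    simp only [snd_smul, map_add, add_smul]; abel)
  zero_smul x := ext (by simp) (by simp)

instance : Module k (DualModule D M) := Module.compHom _ (algebraMap k A)

instance : IsScalarTower k A (DualModule D M) := .of_algebraMap_smul fun _ _ ↦ rfl

end DualModule

/-- The Lie derivative. -/
lemma exists_lieDerivative (D : Derivation k A A) :
    ∃ L : Ω[A⁄k] →+ Ω[A⁄k], ∀ a ω, L (a • ω) = a • L ω + D a • ω := by
  -- For the twisted action `a ↦ (da, d(D a))` is a derivation. Its linear lift is the identity in
  -- the first component (`hT`), and the second component is the required `L`.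
  let δ : Derivation k A (DualModule D Ω[A⁄k]) :=
    { toFun a := DualModule.mk (KaehlerDifferential.D k A a) (KaehlerDifferential.D k A (D a))
      map_add' a b := DualModule.ext (by simp) (by simp)
      map_smul' c a := by
        rw [RingHom.id_apply, ← algebraMap_smul A c (_ : DualModule D Ω[A⁄k])]
        exact DualModule.ext (by rw [DualModule.fst_smul]; simp) (by rw [DualModule.snd_smul]; simp)
      map_one_eq_zero' := DualModule.ext (by simp) (by simp)
      leibniz' a b := DualModule.ext (by simp) (by
        simp only [LinearMap.coe_mk, AddHom.coe_mk, DualModule.snd_smul, map_add,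
          DualModule.snd_mk, DualModule.fst_mk, Derivation.leibniz, smul_eq_mul]
        abel) }
  let T := δ.liftKaehlerDifferential
  have hT (ω : Ω[A⁄k]) : DualModule.fst D _ (T ω) = ω := by
    refine kaehler_induction (p := fun ω ↦ DualModule.fst D _ (T ω) = ω) (by simp)
      (fun x y hx hy ↦ by rw [map_add, map_add, hx, hy])
      (fun a x hx ↦ by rw [map_smul, DualModule.fst_smul, hx]) (fun a ↦ ?_) ω
    exact congr(DualModule.fst D _ $(δ.liftKaehlerDifferential_comp_D a))
  refine ⟨(DualModule.snd D _).comp T.toAddMonoidHom, fun a ω ↦ ?_⟩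
  change DualModule.snd D _ (T (a • ω)) = a • DualModule.snd D _ (T ω) + D a • ω
  rw [map_smul, DualModule.snd_smul, hT]

/-- Applying the Lie derivative to `a • ω = 0` gives `a • L ω + D a • ω = 0`, and the first term
vanishes because `L ω` is again torsion. -/
lemma derivation_mem_annihilator_torsion [IsDomain A] (D : Derivation k A A) {a : A}
    (ha : a ∈ (Submodule.torsion A Ω[A⁄k]).annihilator) :
    D a ∈ (Submodule.torsion A Ω[A⁄k]).annihilator := by
  obtain ⟨L, hL⟩ := exists_lieDerivative D
  rw [Submodule.mem_annihilator] at ha ⊢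
  intro ω hω
  -- If `b` kills `ω`, then `b * b` kills `L ω`: apply `L` to `b • ω = 0` and multiply by `b`.
  have hLω : L ω ∈ Submodule.torsion A Ω[A⁄k] := by
    obtain ⟨b, hb⟩ := hω
    rw [Submonoid.smul_def] at hb
    refine ⟨b * b, ?_⟩
    have := congr((b : A) • L $hb)
    rw [hL, map_zero, smul_zero, smul_add, smul_comm (b : A) (D b), hb, smul_zero, add_zero,
      smul_smul] at this
    exact this
  have := hL a ω
  rw [ha ω hω, map_zero, ha _ hLω, zero_add] at this
  exact this.symm

end Derivations

/-! ### Differentials that surject onto a free module of rank `d` -/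

section FreeDifferentials

variable (k : Type u) {A : Type u} [Field k] [CharZero k] [CommRing A] [IsDomain A] [Algebra k A]
  [Algebra.FiniteType k A]

lemma finrank_kaehlerDifferential_of_isDimension {d : ℕ} (hd : ringKrullDim A = d) :
    Module.finrank A Ω[A⁄k] = d := by
  obtain ⟨n, h1, -, h2⟩ := exists_dimension k A
  rw [h2]
  exact_mod_cast h1.symm.trans hd

include k in
lemma height_eq_of_isMaximal {d : ℕ} (hd : ringKrullDim A = d) (m : Ideal A) [hm : m.IsMaximal] :
    m.height = d := by
  obtain ⟨n, h1, h, -⟩ := exists_dimension k A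
  rw [h m hm]
  exact_mod_cast h1.symm.trans hd

variable {k}
variable {d : ℕ} (c : Ω[A⁄k] →ₗ[A] Fin d → A) (m : Fin d → Ω[A⁄k])
  (hc : ∀ j, c (m j) = Pi.single j 1)

include hc in
omit [CharZero k] [IsDomain A] in
-- The components of `c ∘ d` preserve `P`, so they descend to derivations of `A ⧸ P`. The resulting
-- functionals are dual to the images of the `m j`, which are therefore independent.
lemma le_finrank_kaehlerDifferential_quotient (P : Ideal A) [P.IsPrime]
    (hP : ∀ a ∈ P, ∀ i, c (KaehlerDifferential.D k A a) i ∈ P) :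
    d ≤ Module.finrank (A ⧸ P) Ω[A ⧸ P⁄k] := by
  let π : A →ₐ[k] A ⧸ P := Ideal.Quotient.mkₐ k P
  have hπ : Function.Surjective π := Ideal.Quotient.mkₐ_surjective k P
  let D (i : Fin d) : Derivation k A A :=
    ((LinearMap.proj i).comp c).compDer (KaehlerDifferential.D k A)
  have hD (i : Fin d) (a : A) (ha : π a = 0) : π (D i a) = 0 :=
    Ideal.Quotient.eq_zero_iff_mem.mpr (hP a (Ideal.Quotient.eq_zero_iff_mem.mp ha) i)
  let D' (i : Fin d) : Derivation k (A ⧸ P) (A ⧸ P) := Derivation.liftOfSurjective hπ (hD i)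
  let φ (i : Fin d) := (D' i).liftKaehlerDifferential
  have hφ (i : Fin d) (ω : Ω[A⁄k]) : φ i (KaehlerDifferential.map k k A (A ⧸ P) ω) = π (c ω i) := by
    refine kaehler_induction (p := fun ω ↦ φ i (KaehlerDifferential.map k k A (A ⧸ P) ω) =
      π (c ω i)) (by simp) (fun x y hx hy ↦ by simp [hx, hy]) (fun a x hx ↦ ?_) (fun a ↦ ?_) ω
    · rw [map_smul, map_smul c, Pi.smul_apply, smul_eq_mul, map_mul, ← hx,
        ← algebraMap_smul (A ⧸ P) a, map_smul]
      rfl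
    · rw [KaehlerDifferential.map_D, Derivation.liftKaehlerDifferential_comp_D]
      exact Derivation.liftOfSurjective_apply hπ _ a
  have hind : LinearIndependent (A ⧸ P) fun j ↦ KaehlerDifferential.map k k A (A ⧸ P) (m j) := by
    refine LinearIndependent.of_pairwise_dual_eq_zero_one _ φ (fun i j hij ↦ ?_) fun i ↦ ?_
    · change φ i _ = 0
      rw [hφ, hc, Pi.single_apply, if_neg hij, map_zero]
    · rw [hφ, hc, Pi.single_apply, if_pos rfl, map_one]
  simpa using hind.fintype_card_le_finrank

include hc in
theorem torsion_kaehlerDifferential_eq_bot (hd : ringKrullDim A = d) :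
    Submodule.torsion A Ω[A⁄k] = ⊥ := by
  have : IsNoetherianRing A := Algebra.FiniteType.isNoetherianRing k A
  by_contra hT
  let T := Submodule.torsion A Ω[A⁄k]
  have hF : T.annihilator ≠ ⊤ := fun h ↦ hT (Submodule.annihilator_eq_top_iff.mp h)
  -- The torsion is finitely generated, so one nonzero element kills all of it.
  have hF0 : ∃ a ∈ T.annihilator, a ≠ 0 := by
    obtain ⟨a, ha, ha'⟩ := Submodule.annihilator_top_inter_nonZeroDivisors
      (Submodule.torsion_isTorsion (R := A) (M := Ω[A⁄k]))
    refine ⟨a, ?_, nonZeroDivisors.ne_zero ha'⟩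
    rwa [Submodule.annihilator_top] at ha
  obtain ⟨P, hP⟩ := Ideal.nonempty_minimalPrimes hF
  have : P.IsPrime := hP.1.1
  have h1 := le_finrank_kaehlerDifferential_quotient c m hc P fun a ha i ↦
    derivation_mem_of_mem_minimalPrimes
      (
    ((LinearMap.proj i).comp c).compDer (KaehlerDifferential.D k A))
      (fun a ha ↦ derivation_mem_annihilator_torsion _ ha) hP ha
  obtain ⟨n, h2, -, h3⟩ := exists_dimension k (A ⧸ P)
  obtain ⟨a, ha, ha0⟩ := hF0
  -- As `P` contains the nonzero `a`, `dim A/P + 1 ≤ dim A/(a) + 1 ≤ d`, whereas the rank of `Ω[A ⧸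
  -- P⁄k]` gives `d ≤ dim A/P`.
  have h4 := ringKrullDim_quotient_succ_le_of_nonZeroDivisor (mem_nonZeroDivisors_of_ne_zero ha0)
  have h5 : ringKrullDim (A ⧸ P) ≤ ringKrullDim (A ⧸ Ideal.span {a}) :=
    ringKrullDim_le_of_surjective (Ideal.Quotient.factor
      ((Ideal.span_singleton_le_iff_mem _).mpr (hP.1.2 ha))) (Ideal.Quotient.factor_surjective _)
  rw [h3] at h1
  rw [h2] at h5
  rw [hd] at h4
  have h6 : ((n + 1 : ℕ) : WithBot ℕ∞) ≤ (d : ℕ) := by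
    push_cast
    exact le_trans (by gcongr) h4
  have : n + 1 ≤ d := by exact_mod_cast h6
  omega

include hc in
/-- A surjection from the differentials onto a free module of rank equal to the dimension is
injective. -/
theorem span_range_eq_top (hd : ringKrullDim A = d) : Submodule.span A (Set.range m) = ⊤ := by
  have : IsNoetherianRing A := Algebra.FiniteType.isNoetherianRing k A
  have hsurj : Function.Surjective c := by
    rw [← LinearMap.range_eq_top, eq_top_iff, ← (Pi.basisFun A (Fin d)).span_eq,
      Submodule.span_le]
    rintro _ ⟨j, rfl⟩
    exact ⟨m j, by rw [hc, Pi.basisFun_apply]⟩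
  -- Source and target both have rank `d`, so the kernel has rank zero and is torsion.
  have hker : LinearMap.ker c = ⊥ := by
    rw [eq_bot_iff, ← torsion_kaehlerDifferential_eq_bot c m hc hd]
    have h0 : Module.finrank A (LinearMap.ker c) = 0 := by
      have := (LinearMap.ker c).finrank_quotient_add_finrank
      rw [(c.quotKerEquivOfSurjective hsurj).finrank_eq, Module.finrank_fin_fun,
        finrank_kaehlerDifferential_of_isDimension k hd] at this
      omega
    rw [Module.finrank_eq_zero_iff_isTorsion] at h0
    intro ω hω
    obtain ⟨a, ha⟩ := h0 (x := ⟨ω, hω⟩)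
    exact ⟨a, congr(Subtype.val $ha)⟩
  have hinj := LinearMap.ker_eq_bot.mp hker
  rw [eq_top_iff]
  intro ω _
  have : ω = ∑ j, c ω j • m j := hinj (by
    rw [map_sum]
    simp_rw [map_smul, hc]
    ext i
    simp [Pi.single_apply])
  rw [this]
  exact Submodule.sum_mem _ fun j _ ↦ Submodule.smul_mem _ _ (Submodule.subset_span ⟨j, rfl⟩)

end FreeDifferentials

/-! ### Differentials and cotangent space of a local algebra with residue field `k` -/

section LocalAlgebra

open IsLocalRing

variable {k B : Type u} [Field k] [CommRing B] [IsLocalRing B] [Algebra k B] (ε : B →ₐ[k] k)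

lemma mem_maximalIdeal_iff_eq_zero (b : B) : b ∈ maximalIdeal B ↔ ε b = 0 := by
  have hs : Function.Surjective ε := fun c ↦ ⟨algebraMap k B c, ε.commutes c⟩
  have := RingHom.ker_isMaximal_of_surjective ε hs
  rw [← IsLocalRing.eq_maximalIdeal this, RingHom.mem_ker]

lemma sub_algebraMap_mem (b : B) : b - algebraMap k B (ε b) ∈ maximalIdeal B := by
  rw [mem_maximalIdeal_iff_eq_zero ε, map_sub, ε.commutes]
  exact sub_self _

/-- The derivation sending a function to the class of its difference with its value at the closed
point. -/
def toCotangentDerivation : Derivation k B (CotangentSpace B) where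
  toFun b := (maximalIdeal B).toCotangent ⟨b - algebraMap k B (ε b), sub_algebraMap_mem ε b⟩
  map_add' a b := by
    rw [← map_add]
    congr 1
    ext
    simp only [map_add, AddMemClass.mk_add_mk]
    ring
  map_smul' c a := by
    rw [RingHom.id_apply, ← algebraMap_smul B c ((maximalIdeal B).toCotangent _), ← map_smul]
    congr 1
    ext
    simp only [smul_eq_mul, map_mul, SetLike.mk_smul_mk, Algebra.smul_def, ε.commutes,
      Algebra.algebraMap_self, RingHom.id_apply]
    ring
  map_one_eq_zero' := by simp [← ZeroMemClass.zero_def]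
  leibniz' a b := by
    simp only [LinearMap.coe_mk, AddHom.coe_mk]
    rw [← map_smul, ← map_smul, ← map_add, Ideal.toCotangent_eq]
    simp only [map_mul, SetLike.mk_smul_mk, smul_eq_mul, AddMemClass.mk_add_mk, pow_two]
    have := Ideal.mul_mem_mul (sub_algebraMap_mem ε a) (sub_algebraMap_mem ε b)
    rw [← neg_mem_iff] at this
    convert this using 1
    ring

lemma toCotangentDerivation_lift_surjective :
    Function.Surjective (toCotangentDerivation ε).liftKaehlerDifferential := by
  intro y
  obtain ⟨x, rfl⟩ := (maximalIdeal B).toCotangent_surjective y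
  refine ⟨KaehlerDifferential.D k B x, ?_⟩
  rw [Derivation.liftKaehlerDifferential_comp_D]
  change (maximalIdeal B).toCotangent _ = _
  congr 1
  ext
  simp [(mem_maximalIdeal_iff_eq_zero ε x).mp x.2]

include ε in
-- The cotangent space is a quotient of `Ω[B⁄k]`, so the embedding dimension is at most `d = dim B`.
theorem isRegularLocalRing_of_span_eq_top [IsNoetherianRing B] {d : ℕ} (m : Fin d → Ω[B⁄k])
    (hm : Submodule.span B (Set.range m) = ⊤) (hd : ringKrullDim B = d) :
    IsRegularLocalRing B := by
  apply IsRegularLocalRing.of_spanFinrank_maximalIdeal_le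
  rw [spanFinrank_maximalIdeal_eq_finrank_cotangentSpace, hd]
  let T := (toCotangentDerivation ε).liftKaehlerDifferential
  have h1 : Submodule.span B (Set.range (T ∘ m)) = ⊤ := by
    rw [Set.range_comp, Submodule.span_image, hm, Submodule.map_top,
      LinearMap.range_eq_top.mpr (toCotangentDerivation_lift_surjective ε)]
  have h2 : Submodule.span (ResidueField B) (Set.range (T ∘ m)) = ⊤ := by
    rw [eq_top_iff]
    intro x _
    exact Submodule.span_le_restrictScalars B (ResidueField B) _ (h1 ▸ Submodule.mem_top)
  have h3 := finrank_le_of_span_eq_top h2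
  rw [Fintype.card_fin] at h3
  exact_mod_cast h3

include ε in
-- Nakayama: every `b` is a constant plus an element of the maximal ideal, and by Leibniz the
-- differential of such an element is, modulo the maximal ideal times `Ω[B⁄k]`, a combination of the
-- `d(x i)`.
theorem span_D_eq_top [Module.Finite B Ω[B⁄k]] {ι : Type*} (x : ι → B)
    (hx : Ideal.span (Set.range x) = maximalIdeal B) :
    Submodule.span B (Set.range fun i ↦ KaehlerDifferential.D k B (x i)) = ⊤ := by
  rw [eq_top_iff]
  refine Submodule.le_of_le_smul_of_le_jacobson_bot (I := maximalIdeal B) Module.Finite.fg_top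
    (IsLocalRing.maximalIdeal_le_jacobson _) ?_
  have key (b : B) (hb : b ∈ maximalIdeal B) : KaehlerDifferential.D k B b ∈
      Submodule.span B (Set.range fun i ↦ KaehlerDifferential.D k B (x i)) ⊔
        maximalIdeal B • (⊤ : Submodule B Ω[B⁄k]) := by
    have hb' := hb
    rw [← hx] at hb'
    induction hb' using Submodule.span_induction with
    | mem y hy =>
      obtain ⟨i, rfl⟩ := hy
      exact Submodule.mem_sup_left (Submodule.subset_span ⟨i, rfl⟩)
    | zero => rw [map_zero]; exact zero_mem _
    | add y z hy hz h h' =>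
      rw [map_add]
      exact add_mem (h (hx ▸ hy)) (h' (hx ▸ hz))
    | smul a y hy h =>
      rw [smul_eq_mul, Derivation.leibniz]
      exact add_mem (Submodule.smul_mem _ _ (h (hx ▸ hy)))
        (Submodule.mem_sup_right (Submodule.smul_mem_smul (hx ▸ hy) trivial))
  refine KaehlerDifferential.span_range_derivation k B ▸ Submodule.span_le.mpr ?_
  rintro _ ⟨b, rfl⟩
  rw [KaehlerDifferential.span_range_derivation]
  have h := key _ (sub_algebraMap_mem ε b)
  rw [map_sub, Derivation.map_algebraMap, sub_zero] at h
  exact h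

end LocalAlgebra

/-! ### Passing between an affine algebra and its localization at a closed point -/

section Localization

/-- Clearing denominators: the `t i` represent multiples of the `y i`, every `m` has a multiple in
their span, and the multipliers for a finite generating set of `M` are multiplied together. -/
lemma exists_smul_mem_span {A B M N ι : Type*} [CommRing A] [CommRing B] [Algebra A B]
    [AddCommGroup M] [Module A M] [Module.Finite A M] [AddCommGroup N] [Module A N] [Module B N]
    [IsScalarTower A B N] (S : Submonoid A) [IsLocalization S B] (r : M →ₗ[A] N)
    [IsLocalizedModule S r] (y : ι → N) (hy : Submodule.span B (Set.range y) = ⊤) :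
    ∃ (t : ι → M) (f : A), f ∈ S ∧ ∀ m, f • m ∈ Submodule.span A (Set.range t) := by
  choose p hp using fun i ↦ IsLocalizedModule.surj S r (y i)
  let t (i : ι) := (p i).1
  have h1 (z : N) : ∃ s ∈ S, ∃ m ∈ Submodule.span A (Set.range t), r m = s • z := by
    have hz : z ∈ Submodule.span B (Set.range y) := hy ▸ trivial
    induction hz using Submodule.span_induction with
    | mem z hz =>
      obtain ⟨i, rfl⟩ := hz
      exact ⟨(p i).2, (p i).2.2, t i, Submodule.subset_span ⟨i, rfl⟩, (hp i).symm⟩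
    | zero => exact ⟨1, one_mem _, 0, zero_mem _, by simp⟩
    | add z z' _ _ h h' =>
      obtain ⟨s, hs, m, hm, e⟩ := h
      obtain ⟨s', hs', m', hm', e'⟩ := h'
      refine ⟨s * s', mul_mem hs hs', s' • m + s • m', add_mem (Submodule.smul_mem _ _ hm)
        (Submodule.smul_mem _ _ hm'), ?_⟩
      rw [map_add, map_smul, map_smul, e, e', smul_add, smul_smul, smul_smul, mul_comm s']
    | smul b z _ h =>
      obtain ⟨s, hs, m, hm, e⟩ := h
      obtain ⟨⟨a, s'⟩, ha⟩ := IsLocalization.surj S b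
      refine ⟨s' * s, mul_mem s'.2 hs, a • m, Submodule.smul_mem _ _ hm, ?_⟩
      rw [map_smul, e, ← algebraMap_smul B a, ← ha, ← algebraMap_smul B s z,
        ← algebraMap_smul B (s' * s : A) (b • z), smul_smul, smul_smul, map_mul]
      congr 1
      ring
  have h2 (m : M) : ∃ s ∈ S, s • m ∈ Submodule.span A (Set.range t) := by
    obtain ⟨s, hs, m', hm', e⟩ := h1 (r m)
    rw [← map_smul] at e
    obtain ⟨c, hc⟩ := (IsLocalizedModule.eq_iff_exists S r).mp e
    refine ⟨c * s, mul_mem c.2 hs, ?_⟩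
    rw [mul_smul]
    exact hc ▸ Submodule.smul_mem _ (c : A) hm'
  choose σ hσ hσ' using h2
  obtain ⟨T, hT⟩ := Module.Finite.fg_top (R := A) (M := M)
  refine ⟨t, ∏ m ∈ T, σ m, prod_mem fun m _ ↦ hσ m, fun m ↦ ?_⟩
  have hm : m ∈ Submodule.span A (T : Set M) := hT ▸ trivial
  induction hm using Submodule.span_induction with
  | mem m hm =>
    obtain ⟨q, hq⟩ := Finset.dvd_prod_of_mem σ hm
    rw [hq, mul_comm, mul_smul]
    exact Submodule.smul_mem _ _ (hσ' m)
  | zero => rw [smul_zero]; exact zero_mem _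
  | add m m' _ _ h h' => rw [smul_add]; exact add_mem h h'
  | smul a m _ h => rw [smul_comm]; exact Submodule.smul_mem _ _ h

variable {k A : Type u} [Field k] [IsAlgClosed k] [CommRing A] [Algebra k A] [Algebra.FiniteType k A]

/-- Nullstellensatz: `A ⧸ m` is finite over the algebraically closed `k`, hence equal to it. -/
lemma exists_algHom_of_isMaximal (m : Ideal A) [m.IsMaximal] (B : Type u) [CommRing B] [Algebra k B]
    [Algebra A B] [IsScalarTower k A B] [IsLocalization.AtPrime B m] : Nonempty (B →ₐ[k] k) := by
  let := Ideal.Quotient.field m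
  have : Module.Finite k (A ⧸ m) := finite_of_finite_type_of_isJacobsonRing k (A ⧸ m)
  have hb := IsAlgClosed.algebraMap_bijective_of_isIntegral (k := k) (K := A ⧸ m)
  let e := (AlgEquiv.ofBijective (Algebra.ofId k (A ⧸ m)) hb).symm
  let ε₀ : A →ₐ[k] k := (e : A ⧸ m →ₐ[k] k).comp (Ideal.Quotient.mkₐ k m)
  refine ⟨IsLocalization.liftAlgHom (M := m.primeCompl) (f := ε₀) fun y ↦ ?_⟩
  rw [isUnit_iff_ne_zero]
  intro h
  refine y.2 (Ideal.Quotient.eq_zero_iff_mem.mp ?_)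
  exact e.injective (h.trans (map_zero e).symm)

variable [CharZero k] [IsDomain A] {d : ℕ} (hd : ringKrullDim A = d) (m : Ideal A) [m.IsMaximal]
  (B : Type u) [CommRing B] [Algebra A B] [IsLocalization.AtPrime B m]

include hd m in
theorem isRegularLocalRing_localization (t : Fin d → Ω[A⁄k])
    (ht : Submodule.span A (Set.range t) = ⊤) : IsRegularLocalRing B := by
  let : Algebra k B := Algebra.compHom B (algebraMap k A)
  have : IsScalarTower k A B := .of_algebraMap_eq fun _ ↦ rfl
  have : IsLocalRing B := IsLocalization.AtPrime.isLocalRing B m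
  have : IsNoetherianRing A := Algebra.FiniteType.isNoetherianRing k A
  have : IsNoetherianRing B := IsLocalization.isNoetherianRing m.primeCompl B inferInstance
  obtain ⟨ε⟩ := exists_algHom_of_isMaximal (k := k) m B
  refine isRegularLocalRing_of_span_eq_top ε (KaehlerDifferential.map k k A B ∘ t) ?_ ?_
  · rw [Set.range_comp]
    exact span_eq_top_of_isLocalizedModule B m.primeCompl (KaehlerDifferential.map k k A B) ht
  · rw [IsLocalization.AtPrime.ringKrullDim_eq_height m B, height_eq_of_isMaximal k hd m]
    rfl

include hd m in
-- Regularity provides `d` generators of the maximal ideal of `B`. Their differentials generate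
-- `Ω[B⁄k]`, and clearing denominators brings them down to `A`.
theorem exists_smul_mem_span_of_isRegularLocalRing [IsRegularLocalRing B] :
    ∃ (t : Fin d → Ω[A⁄k]) (f : A), f ∉ m ∧ ∀ ω, f • ω ∈ Submodule.span A (Set.range t) := by
  let : Algebra k B := Algebra.compHom B (algebraMap k A)
  have : IsScalarTower k A B := .of_algebraMap_eq fun _ ↦ rfl
  have : IsNoetherianRing A := Algebra.FiniteType.isNoetherianRing k A
  obtain ⟨ε⟩ := exists_algHom_of_isMaximal (k := k) m B
  have h1 : ((IsLocalRing.maximalIdeal B).spanFinrank : WithBot ℕ∞) = d := by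
    rw [IsRegularLocalRing.spanFinrank_maximalIdeal,
      IsLocalization.AtPrime.ringKrullDim_eq_height m B, height_eq_of_isMaximal k hd m]
    rfl
  have h1 : (IsLocalRing.maximalIdeal B).spanFinrank = d := by exact_mod_cast h1
  obtain ⟨x, hx⟩ : ∃ x : Fin d → B, Ideal.span (Set.range x) = IsLocalRing.maximalIdeal B := by
    obtain ⟨s, hs, hs'⟩ := Submodule.FG.exists_span_set_encard_eq_spanFinrank
      (IsLocalRing.maximalIdeal B).fg_of_isNoetherianRing
    rw [h1] at hs
    have hfin : s.Finite := Set.finite_of_encard_eq_coe hs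
    have := hfin.fintype
    let e : Fin d ≃ s := (Fintype.equivFinOfCardEq (by
      rw [← Nat.card_eq_fintype_card, Nat.card_coe_set_eq, Set.ncard, hs]; rfl)).symm
    refine ⟨fun i ↦ e i, ?_⟩
    rw [← hs']
    congr 1
    exact (e.surjective.range_comp Subtype.val).trans Subtype.range_coe
  have : Module.Finite B Ω[B⁄k] := Module.Finite.of_isLocalizedModule m.primeCompl
    (KaehlerDifferential.map k k A B)
  exact exists_smul_mem_span m.primeCompl (KaehlerDifferential.map k k A B) _ (span_D_eq_top ε x hx)

end Localization

/-! ### The dimension of a variety on its affine opens -/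

section Dimension

lemma finrank_kaehlerDifferential_localization (k A B : Type*) [CommRing k] [CommRing A] [IsDomain A]
    [Algebra k A] [CommRing B] [Algebra A B] [Algebra k B] [IsScalarTower k A B]
    (S : Submonoid A) (hS : S ≤ nonZeroDivisors A) [IsLocalization S B] :
    Module.finrank B Ω[B⁄k] = Module.finrank A Ω[A⁄k] := by
  rw [← IsLocalizedModule.finrank_eq S (KaehlerDifferential.map k k A B) hS]
  exact IsLocalization.finrank_eq B S hS

attribute [local instance] specializationOrder in
-- Irreducible closed subsets correspond to their generic points, and the dimension of a stalk is
-- the coheight of the point in the specialization order.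
lemma topologicalKrullDim_eq_iSup_stalk (X : Scheme.{u}) :
    topologicalKrullDim X = ⨆ x : X, ringKrullDim (X.presheaf.stalk x) := by
  rw [topologicalKrullDim, Order.krullDim_eq_of_orderIso irreducibleSetEquivPoints,
    Order.krullDim_eq_iSup_coheight]
  simp_rw [ringKrullDim_stalk_eq_coheight]

variable {k : Type u} [Field k] {X : Scheme.{u}} (f : X ⟶ Spec (.of k)) [IsIntegral X]

lemma isDomain_sections {U : X.AffineZariskiSite} {x : X} (hx : x ∈ U.toOpens) :
    IsDomain Γ(X, U.toOpens) :=
  have : Nonempty U.toOpens := ⟨⟨x, hx⟩⟩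
  inferInstance

omit [IsIntegral X] in
lemma finiteType_sections [LocallyOfFiniteType f] (U : X.AffineZariskiSite) :
    letI := sectionsAlgebra f U
    Algebra.FiniteType k Γ(X, U.toOpens) := by
  let := sectionsAlgebra f U
  rw [← RingHom.finiteType_algebraMap]
  change ((Scheme.ΓSpecIso (.of k)).inv ≫ f.appLE ⊤ U.toOpens le_top).hom.FiniteType
  rw [CommRingCat.hom_comp]
  exact (f.finiteType_appLE (isAffineOpen_top _) U.2 _).comp
    (.of_surjective _ (ConcreteCategory.bijective_of_isIso (Scheme.ΓSpecIso (.of k)).inv).2)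

variable [CharZero k] [LocallyOfFiniteType f]

omit [CharZero k] [LocallyOfFiniteType f] in
lemma finrank_sections_of_le {U V : X.AffineZariskiSite} (h : U ≤ V) {x : X} (hx : x ∈ U.toOpens) :
    letI := sectionsAlgebra f U
    letI := sectionsAlgebra f V
    Module.finrank Γ(X, U.toOpens) Ω[Γ(X, U.toOpens)⁄k] =
      Module.finrank Γ(X, V.toOpens) Ω[Γ(X, V.toOpens)⁄k] := by
  obtain ⟨g, hg⟩ := h
  obtain rfl : V.basicOpen g = U := Subtype.ext hg
  let := sectionsAlgebra f V
  let := sectionsAlgebra f (V.basicOpen g)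
  let : Algebra Γ(X, V.toOpens) Γ(X, (V.basicOpen g).toOpens) :=
    (restr (V.basicOpen_le g)).toAlgebra
  have : IsScalarTower k Γ(X, V.toOpens) Γ(X, (V.basicOpen g).toOpens) :=
    .of_algebraMap_eq fun c ↦ (restr_sectionsAlgebra f (V.basicOpen_le g) c).symm
  have : IsLocalization.Away g Γ(X, (V.basicOpen g).toOpens) := V.2.isLocalization_basicOpen g
  have := isDomain_sections (Scheme.AffineZariskiSite.toOpens_mono (V.basicOpen_le g) hx)
  have hg0 : g ≠ 0 := by
    rintro rfl
    change x ∈ X.basicOpen _ at hx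
    simp at hx
  exact finrank_kaehlerDifferential_localization k _ _ (Submonoid.powers g)
    (powers_le_nonZeroDivisors_of_noZeroDivisors hg0)

include f in
-- The dimension is the rank of the differentials, and that rank is unchanged on a nonempty open
-- that is basic in both `U` and `V`.
lemma ringKrullDim_sections_eq {U V : X.AffineZariskiSite} {x y : X} (hx : x ∈ U.toOpens)
    (hy : y ∈ V.toOpens) :
    ringKrullDim Γ(X, U.toOpens) = ringKrullDim Γ(X, V.toOpens) := by
  obtain ⟨z, hzU, hzV⟩ := nonempty_preirreducible_inter U.1.2 V.1.2 ⟨x, hx⟩ ⟨y, hy⟩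
  obtain ⟨g, g', hg, hz⟩ := exists_basicOpen_le_affine_inter U.2 V.2 z ⟨hzU, hzV⟩
  let := sectionsAlgebra f U
  let := sectionsAlgebra f V
  have := finiteType_sections f U
  have := finiteType_sections f V
  have := isDomain_sections hx
  have := isDomain_sections hy
  obtain ⟨n, h1, -, h2⟩ := exists_dimension k Γ(X, U.toOpens)
  obtain ⟨n', h1', -, h2'⟩ := exists_dimension k Γ(X, V.toOpens)
  have hU := finrank_sections_of_le f (U.basicOpen_le g) hz
  have hV := finrank_sections_of_le f (U := U.basicOpen g) (V := V) ⟨g', hg.symm⟩ hz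
  rw [h1, h1', ← h2, ← h2', ← hU, ← hV]

include f in
-- The dimension of `X` is the supremum over the stalks. Each stalk localizes an affine ring of the
-- same dimension as `Γ(X, U)`, and a maximal ideal of `Γ(X, U)` attains the bound.
theorem ringKrullDim_sections {U : X.AffineZariskiSite} {x : X} (hx : x ∈ U.toOpens) :
    ringKrullDim Γ(X, U.toOpens) = dim X := by
  have key : topologicalKrullDim X = ringKrullDim Γ(X, U.toOpens) := by
    rw [topologicalKrullDim_eq_iSup_stalk]
    refine le_antisymm (iSup_le fun y ↦ ?_) ?_
    · obtain ⟨_, ⟨V, hV, rfl⟩, hyV, -⟩ :=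
        X.isBasis_affineOpens.exists_subset_of_mem_open (Set.mem_univ y) isOpen_univ
      rw [ringKrullDim_sections_eq f (V := ⟨V, hV⟩) hx hyV]
      let := X.presheaf.algebra_section_stalk (⟨y, hyV⟩ : V)
      have : IsLocalization.AtPrime (X.presheaf.stalk y) (hV.primeIdealOf ⟨y, hyV⟩).asIdeal :=
        hV.isLocalization_stalk ⟨y, hyV⟩
      rw [IsLocalization.AtPrime.ringKrullDim_eq_height (hV.primeIdealOf ⟨y, hyV⟩).asIdeal]
      exact Ideal.height_le_ringKrullDim_of_ne_top Ideal.IsPrime.ne_top'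
    · have := isDomain_sections hx
      let := sectionsAlgebra f U
      have := finiteType_sections f U
      obtain ⟨n, h1, h2, -⟩ := exists_dimension k Γ(X, U.toOpens)
      obtain ⟨m, hm⟩ := Ideal.exists_maximal Γ(X, U.toOpens)
      let p : PrimeSpectrum Γ(X, U.toOpens) := ⟨m, hm.isPrime⟩
      have hp : U.2.fromSpec p ∈ U.toOpens := U.2.range_fromSpec.le ⟨p, rfl⟩
      let := X.presheaf.algebra_section_stalk (⟨U.2.fromSpec p, hp⟩ : U.toOpens)
      have : IsLocalization.AtPrime (X.presheaf.stalk (U.2.fromSpec p)) p.asIdeal :=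
        U.2.isLocalization_stalk' p hp
      refine le_trans (le_of_eq ?_)
        (le_iSup (fun y ↦ ringKrullDim (X.presheaf.stalk y)) (U.2.fromSpec p))
      rw [h1]
      refine Eq.trans ?_ (IsLocalization.AtPrime.ringKrullDim_eq_height p.asIdeal
        (X.presheaf.stalk (U.2.fromSpec p))).symm
      rw [h2 m hm]
      rfl
  have := isDomain_sections hx
  let := sectionsAlgebra f U
  have := finiteType_sections f U
  obtain ⟨n, h1, h2, -⟩ := exists_dimension k Γ(X, U.toOpens)
  -- The Krull dimension is a natural number here, so the default values in `dim` do not intervene.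
  rw [dim, key, h1]
  rfl

end Dimension

/-! ### Sections of the Grassmannian in coordinates -/

section Charts

variable {X : Scheme.{u}} {F : QCohModule X} {d : ℕ}

/-- The inclusion of a chart into the Grassmannian. -/
def chartι (i : ChartIndex F d) : Spec (.of i.ring) ⟶ grassmannian F d :=
  colimit.ι (chartDiagram F d) i

instance (i : ChartIndex F d) : IsOpenImmersion (chartι i) :=
  inferInstanceAs (IsOpenImmersion (colimit.ι (chartDiagram F d) i))

lemma chartι_toBase (i : ChartIndex F d) : chartι i ≫ grassmannianToBase F d =
    Spec.map (CommRingCat.ofHom (algebraMap Γ(X, i.U.toOpens) i.ring)) ≫ i.U.2.fromSpec :=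
  colimit.ι_desc _ _

lemma chartMap_chartι {i j : ChartIndex F d} (h : i ≤ j) : chartMap h ≫ chartι j = chartι i :=
  colimit.w (chartDiagram F d) h.hom

lemma exists_chartι_eq (y : ↥(grassmannian F d)) : ∃ (i : ChartIndex F d) (z : _), chartι i z = y :=
  Scheme.IsLocallyDirected.ι_jointly_surjective (chartDiagram F d) y

lemma toBase_chartι_mem (i : ChartIndex F d) (z : _) :
    grassmannianToBase F d (chartι i z) ∈ i.U.toOpens := by
  rw [← Scheme.Hom.comp_apply, chartι_toBase, Scheme.Hom.comp_apply]
  exact i.U.2.range_fromSpec.le ⟨_, rfl⟩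

/-- Near each point, a section of the Grassmannian is given by coordinates. -/
lemma exists_coord_of_section (s : X ⟶ grassmannian F d)
    (hs : s ≫ grassmannianToBase F d = 𝟙 X) (x : X) :
    ∃ (W : X.AffineZariskiSite) (_ : x ∈ W.toOpens) (c : F.sec W →ₗ[Γ(X, W.toOpens)]
      Fin d → Γ(X, W.toOpens)) (m : Fin d → F.sec W), ∀ j, c (m j) = Pi.single j 1 := by
  obtain ⟨i, z, hz⟩ := exists_chartι_eq (s x)
  have hx : x ∈ i.U.toOpens := by
    have := toBase_chartι_mem i z
    rwa [hz, ← Scheme.Hom.comp_apply, hs] at this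
  -- Shrink to a basic open `W` that `s` maps into a single chart, so that `s` becomes a ring
  -- homomorphism `ρ` out of the chart ring.
  obtain ⟨g, hg, hxg⟩ := i.U.2.exists_basicOpen_le (V := s ⁻¹ᵁ (chartι i).opensRange)
    ⟨x, z, hz⟩ hx
  let W := i.U.basicOpen g
  have hW : W ≤ i.U := i.U.basicOpen_le g
  let φ : Spec Γ(X, W.toOpens) ⟶ Spec (.of i.ring) :=
    IsOpenImmersion.lift (chartι i) (W.2.fromSpec ≫ s) (by
      rintro _ ⟨y, rfl⟩
      rw [Scheme.Hom.comp_apply]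
      exact hg (W.2.range_fromSpec.le ⟨y, rfl⟩))
  have hφ : φ ≫ chartι i = W.2.fromSpec ≫ s := IsOpenImmersion.lift_fac ..
  obtain ⟨ρ, hρ⟩ := Spec.map_surjective φ
  have h1 : CommRingCat.ofHom (algebraMap Γ(X, i.U.toOpens) i.ring) ≫ ρ =
      CommRingCat.ofHom (restr hW) := by
    apply Spec.map_injective
    rw [← cancel_mono i.U.2.fromSpec, Spec.map_comp, Category.assoc, ← chartι_toBase, hρ,
      reassoc_of% hφ, hs, Category.comp_id]
    exact (i.U.2.map_fromSpec W.2 _).symm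
  let : Algebra Γ(X, i.U.toOpens) Γ(X, W.toOpens) := (restr hW).toAlgebra
  have : IsLocalization.Away g Γ(X, W.toOpens) := i.U.2.isLocalization_basicOpen g
  obtain ⟨t, ht⟩ := i.nonempty
  -- Through `ρ` the universal coordinates are functions on sections over `i.U`; they extend to
  -- sections over `W`. They are linear over `Γ(X, W)` itself because `s` is a section (`h1`).
  obtain ⟨c, hc_add, hc_smul, hc⟩ := exists_extend_coord g (F.res hW) (F.exists_res_eq i.U g)
    (F.exists_pow_smul_eq_zero i.U g) ⟨t, ht⟩ ρ.hom (RingHom.id _)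
    (fun a ↦ congr($h1 a).symm)
  refine ⟨W, hxg, ⟨⟨c, hc_add⟩, fun a m ↦ funext fun j ↦ hc_smul a m j⟩, F.res hW ∘ t, fun j ↦ ?_⟩
  ext a
  refine (hc (t j) a).trans ?_
  rw [coord_self (S := i.S) ⟨t, ht⟩, Pi.single_apply]
  simp only [eq_comm]
  split_ifs <;> simp

end Charts

/-! ### A section of the Grassmannian forces regularity -/

section Section

variable {k : Type u} [Field k] [IsAlgClosed k] [CharZero k] {X : Scheme.{u}} (f : X ⟶ Spec (.of k))
  [IsIntegral X] [LocallyOfFiniteType f]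

theorem isRegularVariety_of_section (s : X ⟶ grassmannian (differentials f) (dim X))
    (hs : s ≫ grassmannianToBase (differentials f) (dim X) = 𝟙 X) : IsRegularVariety X := by
  intro x hx
  obtain ⟨W, hxW, c, m, hc⟩ := exists_coord_of_section s hs x
  let := sectionsAlgebra f W
  have := isDomain_sections hxW
  have := finiteType_sections f W
  have hd := ringKrullDim_sections f hxW
  have hm := span_range_eq_top (k := k) (A := Γ(X, W.toOpens)) c m hc hd
  have : (W.2.primeIdealOf ⟨x, hxW⟩).asIdeal.IsMaximal :=
    W.2.primeIdealOf_isMaximal_of_isClosed ⟨x, hxW⟩ hx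
  let := X.presheaf.algebra_section_stalk (⟨x, hxW⟩ : W.toOpens)
  have : IsLocalization.AtPrime (X.presheaf.stalk x) (W.2.primeIdealOf ⟨x, hxW⟩).asIdeal :=
    W.2.isLocalization_stalk ⟨x, hxW⟩
  exact isRegularLocalRing_localization (k := k) hd (W.2.primeIdealOf ⟨x, hxW⟩).asIdeal
    (X.presheaf.stalk x) m hm

end Section

/-! ### The Nash modification inside the Grassmannian -/

section Nash

variable {k : Type u} [Field k] {X : Scheme.{u}} (f : X ⟶ Spec (.of k))

/-- The inclusion of the Nash modification into the Grassmannian. -/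
def nashι : nash f ⟶ grassmannian (differentials f) (dim X) :=
  Scheme.IdealSheafData.subschemeι _

lemma nashι_toBase : nashι f ≫ grassmannianToBase (differentials f) (dim X) = nashToBase f := rfl

instance : IsClosedImmersion (nashι f) :=
  inferInstanceAs (IsClosedImmersion (Scheme.IdealSheafData.subschemeι _))

lemma range_nashι : Set.range (nashι f) =
    closure (grassmannianToBase (differentials f) (dim X) ⁻¹' regularLocus X) :=
  (Scheme.IdealSheafData.range_subschemeι _).trans (by simp)

theorem isRegularVariety_of_isIso_nashToBase [IsAlgClosed k] [CharZero k] [IsIntegral X]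
    [LocallyOfFiniteType f] [IsIso (nashToBase f)] : IsRegularVariety X :=
  isRegularVariety_of_section f (inv (nashToBase f) ≫ nashι f) (by
    rw [Category.assoc, nashι_toBase, IsIso.inv_hom_id])

end Nash

/-! ### The Grassmannian of a locally free module of rank `d` -/

section LocallyFree

variable {X : Scheme.{u}} {F : QCohModule X} {d : ℕ}

lemma span_res_of_smul_mem {V : X.AffineZariskiSite} (g : Γ(X, V.toOpens)) (t : Fin d → F.sec V)
    (h : ∀ m, g • m ∈ Submodule.span Γ(X, V.toOpens) (Set.range t)) :
    Submodule.span Γ(X, (V.basicOpen g).toOpens) (Set.range (F.res (V.basicOpen_le g) ∘ t)) = ⊤ := by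
  rw [eq_top_iff]
  intro ω _
  obtain ⟨n, m, hm⟩ := F.exists_res_eq V g ω
  have hu : IsUnit (restr (V.basicOpen_le g) g ^ (n + 1)) :=
    (isUnit_restr (V.basicOpen_le g) g rfl).pow _
  rw [← Submodule.smul_mem_iff_of_isUnit _ hu, pow_succ', mul_smul, ← hm, ← map_smulₛₗ]
  generalize g • m = m', h m = hm'
  induction hm' using Submodule.span_induction with
  | mem x hx =>
    obtain ⟨i, rfl⟩ := hx
    exact Submodule.subset_span ⟨i, rfl⟩
  | zero => rw [map_zero]; exact zero_mem _
  | add x y _ _ hx hy => rw [map_add]; exact add_mem hx hy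
  | smul a x _ hx => rw [map_smulₛₗ]; exact Submodule.smul_mem _ _ hx

lemma span_res {U V : X.AffineZariskiSite} (hUV : U ≤ V) (t : Fin d → F.sec V)
    (h : Submodule.span Γ(X, V.toOpens) (Set.range t) = ⊤) :
    Submodule.span Γ(X, U.toOpens) (Set.range (F.res hUV ∘ t)) = ⊤ := by
  obtain ⟨g, hg⟩ := hUV
  obtain rfl : V.basicOpen g = U := Subtype.ext hg
  exact span_res_of_smul_mem g t fun m ↦ h ▸ trivial

/-- Expressing `s` through the generators `t` gives a one-sided inverse of the matrix, which
suffices for square matrices. -/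
lemma isUnit_mat_of_span {A B M : Type u} [CommRing A] [CommRing B] [AddCommGroup M] [Module A M]
    (ψ : A →+* B) (c : M → Fin d → B)
    (hc_add : ∀ m n, c (m + n) = c m + c n) (hc_smul : ∀ a m i, c (a • m) i = ψ a * c m i)
    (t s : Fin d → M)
    (ht : Submodule.span A (Set.range t) = ⊤) (hs : ∀ j i, c (s j) i = if j = i then 1 else 0) :
    IsUnit (mat c t) := by
  have (j : Fin d) : ∃ a : Fin d → A, ∑ l, a l • t l = s j :=
    (Submodule.mem_span_range_iff_exists_fun A).mp (ht ▸ trivial)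
  choose a ha using this
  refine IsUnit.of_mul_eq_one_right (Matrix.of fun j l ↦ ψ (a j l)) ?_
  ext j i
  let φ : M →ₛₗ[ψ] Fin d → B := ⟨⟨c, hc_add⟩, fun a m ↦ funext fun i ↦ hc_smul a m i⟩
  have hφ : c (∑ l, a j l • t l) = ∑ l, c (a j l • t l) := map_sum φ _ _
  rw [Matrix.mul_apply, Matrix.one_apply, ← hs j i, ← ha j, hφ, Finset.sum_apply]
  simp [mat, hc_smul]

/-- The coordinates with respect to a basis of `M` are forced to be those of `b.repr`, so the chart
ring acquires no new elements. -/
lemma algebraMap_chartRing_bijective {A M : Type u} [CommRing A] [AddCommGroup M] [Module A M]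
    (t : Fin d → M) (b : Module.Basis (Fin d) A M) (hb : ⇑b = t) :
    Function.Bijective (algebraMap A (ChartRing A M {t})) := by
  subst hb
  let ρ : ChartRing A M {⇑b} →+* A := ChartRing.lift (RingHom.id A) (fun _ m i ↦ b.repr m i)
    (by simp) (by simp) (by
      rintro ⟨s, hs⟩ j i
      obtain rfl := Finset.mem_singleton.mp hs
      simp [Finsupp.single_apply]) (by
      rintro ⟨s, hs⟩ ⟨s', hs'⟩ m i
      obtain rfl := Finset.mem_singleton.mp hs
      simp [Finsupp.single_apply])
  have h1 : ρ.comp (algebraMap A _) = RingHom.id A := RingHom.ext fun a ↦ by simp [ρ]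
  have h2 : (algebraMap A _).comp ρ = RingHom.id _ := by
    refine ChartRing.hom_ext (fun a ↦ by simp [ρ]) ?_
    rintro ⟨s, hs⟩ m i
    obtain rfl := Finset.mem_singleton.mp hs
    have key (a : Fin d → A) : coord (R := A) ⟨⇑b, hs⟩ (∑ j, a j • b j) i = algebraMap A _ (a i) := by
      let φ : M →ₗ[A] ChartRing A M {⇑b} :=
        { toFun m := coord ⟨⇑b, hs⟩ m i
          map_add' _ _ := coord_add ..
          map_smul' _ _ := (coord_smul ..).trans (Algebra.smul_def _ _).symm }
      change φ _ = _
      rw [map_sum]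
      simp only [map_smul]
      change ∑ j, a j • coord ⟨⇑b, hs⟩ (b j) i = _
      have hself (j) : coord (R := A) ⟨⇑b, hs⟩ (b j) i = if j = i then 1 else 0 :=
        coord_self (S := {⇑b}) ⟨⇑b, hs⟩ j i
      simp [hself]
      exact (Algebra.algebraMap_eq_smul_one _).symm
    simp only [RingHom.comp_apply, ρ, ChartRing.lift_coord, RingHom.id_apply]
    rw [← key, b.sum_repr]
  exact ⟨Function.LeftInverse.injective (g := ρ) fun a ↦ congr($h1 a),
    Function.RightInverse.surjective (g := ρ) fun a ↦ congr($h2 a)⟩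

/-- A point of a chart lies in a smaller chart if it lies over the smaller base and the new tuples
generate the module. -/
lemma exists_chartMap_eq {l i : ChartIndex F d} (h : l ≤ i)
    (hS : ∀ s ∈ l.S, (∃ s' ∈ i.S, F.res h.1 ∘ s' = s) ∨
      Submodule.span Γ(X, l.U.toOpens) (Set.range s) = ⊤)
    (z : Spec (.of i.ring)) (hz : grassmannianToBase F d (chartι i z) ∈ l.U.toOpens) :
    ∃ w, chartMap h w = z := by
  obtain ⟨U, S, hS'⟩ := l
  obtain ⟨V, T, hT⟩ := i
  obtain ⟨⟨g, hg⟩, H⟩ := h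
  obtain rfl : V.basicOpen g = U := Subtype.ext hg
  let l : ChartIndex F d := ⟨V.basicOpen g, S, hS'⟩
  let i : ChartIndex F d := ⟨V, T, hT⟩
  have h : l ≤ i := ⟨⟨g, hg⟩, H⟩
  obtain ⟨t, ht⟩ := hT
  -- The point is viewed as a homomorphism `ρ` to its residue field; it remains to extend `ρ` to the
  -- smaller chart's ring, by inverting `g` and checking that each tuple of that chart has an
  -- invertible matrix.
  obtain ⟨ρ, hρ⟩ := Spec.map_surjective ((Spec (.of i.ring)).fromSpecResidueField z)
  let K := (Spec (.of i.ring)).residueField z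
  let p : Spec K := default
  have hp : Spec.map ρ p = z := by rw [hρ]; exact Scheme.fromSpecResidueField_apply ..
  have hgu : IsUnit (ρ.hom (algebraMap _ _ g)) := by
    rw [isUnit_iff_ne_zero]
    intro h0
    rw [← hp, ← Scheme.Hom.comp_apply, chartι_toBase, ← hg, Scheme.Hom.comp_apply,
      ← Scheme.Hom.mem_preimage, i.U.2.fromSpec_preimage_basicOpen] at hz
    refine hz ?_
    change ρ.hom (algebraMap _ _ g) ∈ p.asIdeal
    rw [h0]
    exact zero_mem _
  let : Algebra Γ(X, i.U.toOpens) Γ(X, l.U.toOpens) := (restr h.1).toAlgebra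
  have : IsLocalization.Away g Γ(X, l.U.toOpens) := V.2.isLocalization_basicOpen g
  let ψ : Γ(X, l.U.toOpens) →+* K := IsLocalization.Away.lift g
    (g := ρ.hom.comp (algebraMap _ i.ring)) hgu
  have hψ (a) : ψ (restr h.1 a) = ρ.hom (algebraMap _ _ a) :=
    IsLocalization.Away.lift_eq g hgu a
  obtain ⟨c, hc_add, hc_smul, hc⟩ := exists_extend_coord g (F.res h.1)
    (F.exists_res_eq V g) (F.exists_pow_smul_eq_zero V g) ⟨t, ht⟩ ρ.hom ψ hψ
  obtain ⟨α, hα⟩ := ChartRing.exists_extension (S' := l.S) (F.res h.1) h.2 ht ρ.hom ψ hψ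
    c hc_add hc_smul hc (by
    intro s hs
    obtain ⟨s', hs', rfl⟩ | hs := hS s hs
    · have e : mat c (F.res h.1 ∘ s') = ρ.hom.mapMatrix (mat (coord ⟨t, ht⟩) s') := by
        ext a b
        exact hc (s' a) b
      rw [e]
      exact (IsUnit.of_mul_eq_one _ (mat_mul_mat (R := Γ(X, i.U.toOpens)) _ ⟨s', hs'⟩)).map
        ρ.hom.mapMatrix
    · refine isUnit_mat_of_span ψ c hc_add hc_smul s (F.res h.1 ∘ t) hs fun j a ↦ ?_
      refine (hc (t j) a).trans ?_
      rw [coord_self (S := i.S) ⟨t, ht⟩]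
      split_ifs <;> simp)
  refine ⟨Spec.map (CommRingCat.ofHom α) p, ?_⟩
  have e : Spec.map (CommRingCat.ofHom α) ≫ chartMap h = Spec.map ρ := by
    rw [chartMap, ← Spec.map_comp]
    congr 1
    ext1
    exact hα
  rw [← Scheme.Hom.comp_apply]
  exact congr($e p).trans hp

end LocallyFree

section LocallyFree

variable {X : Scheme.{u}} {F : QCohModule X} {d : ℕ}

/-- The chart of a single tuple. -/
def singleChart (U : X.AffineZariskiSite) (t : Fin d → F.sec U) : ChartIndex F d :=
  ⟨U, {t}, Finset.singleton_nonempty t⟩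

open Classical in
/-- If `t` generates `F` over `U`, the chart of `t` is the whole preimage of `U`. -/
lemma opensRange_chartι_singleChart (U : X.AffineZariskiSite) (t : Fin d → F.sec U)
    (ht : Submodule.span Γ(X, U.toOpens) (Set.range t) = ⊤) :
    (chartι (singleChart U t)).opensRange = grassmannianToBase F d ⁻¹ᵁ U.toOpens := by
  ext y
  refine ⟨?_, fun hy ↦ ?_⟩
  · rintro ⟨z, rfl⟩
    exact toBase_chartι_mem (singleChart U t) z
  obtain ⟨i, z, rfl⟩ := exists_chartι_eq y
  obtain ⟨g, g', hg, hz⟩ := exists_basicOpen_le_affine_inter U.2 i.U.2 _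
    ⟨hy, toBase_chartι_mem i z⟩
  have hU : U.basicOpen g ≤ U := U.basicOpen_le g
  have hi : U.basicOpen g ≤ i.U := ⟨g', hg.symm⟩
  -- A chart below both `i` and the chart of `t`. Adding `t` to the tuples of `i` loses no points,
  -- since `t` generates.
  let l : ChartIndex F d := ⟨U.basicOpen g, i.S.image (F.res hi ∘ ·) ∪ {F.res hU ∘ t}, by simp⟩
  have hli : l ≤ i := ⟨hi, fun s hs ↦
    Finset.mem_union_left _ (Finset.mem_image_of_mem (F.res hi ∘ ·) hs)⟩
  have hlU : l ≤ singleChart U t := ⟨hU, fun s hs ↦ Finset.mem_union_right _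
    (Finset.mem_singleton.mpr (congrArg (F.res hU ∘ ·) (Finset.mem_singleton.mp hs)))⟩
  obtain ⟨w, rfl⟩ := exists_chartMap_eq hli (fun s hs ↦ by
    obtain hs | hs := Finset.mem_union.mp hs
    · obtain ⟨s', hs', rfl⟩ := Finset.mem_image.mp hs
      exact .inl ⟨s', hs', rfl⟩
    · obtain rfl := Finset.mem_singleton.mp hs
      exact .inr (span_res hU t ht)) z hz
  refine ⟨chartMap hlU w, ?_⟩
  rw [← Scheme.Hom.comp_apply, ← Scheme.Hom.comp_apply, chartMap_chartι, chartMap_chartι]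

/-- The preimage of `U` is the chart of the basis, where the structure morphism is the bijective
`algebraMap` on rings. -/
lemma isIso_toBase_restrict (U : X.AffineZariskiSite)
    (b : Module.Basis (Fin d) Γ(X, U.toOpens) (F.sec U)) :
    IsIso (grassmannianToBase F d ∣_ U.toOpens) := by
  let i := singleChart U b
  let e := IsOpenImmersion.isoOfRangeEq (chartι i) (grassmannianToBase F d ⁻¹ᵁ U.toOpens).ι (by
    rw [Scheme.Opens.range_ι, ← opensRange_chartι_singleChart U b b.span_eq]
    rfl)
  have he : e.hom ≫ (grassmannianToBase F d ⁻¹ᵁ U.toOpens).ι = chartι i :=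
    IsOpenImmersion.isoOfRangeEq_hom_fac ..
  have : IsIso (CommRingCat.ofHom (algebraMap Γ(X, i.U.toOpens) i.ring)) :=
    (ConcreteCategory.isIso_iff_bijective _).mpr (algebraMap_chartRing_bijective _ b rfl)
  have key : e.hom ≫ grassmannianToBase F d ∣_ U.toOpens =
      Spec.map (CommRingCat.ofHom (algebraMap Γ(X, i.U.toOpens) i.ring)) ≫ U.2.isoSpec.inv := by
    rw [← cancel_mono U.toOpens.ι, Category.assoc, morphismRestrict_ι, reassoc_of% he,
      chartι_toBase]
    exact (Category.assoc _ _ U.toOpens.ι).symm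
  rw [← isIso_comp_left_iff e.hom, key]
  exact IsIso.comp_isIso' inferInstance U.2.isoSpec.isIso_inv

theorem isIso_toBase (h : ∀ x : X, ∃ U : X.AffineZariskiSite, x ∈ U.toOpens ∧
    Nonempty (Module.Basis (Fin d) Γ(X, U.toOpens) (F.sec U))) :
    IsIso (grassmannianToBase F d) := by
  choose U hU hb using h
  refine (IsZariskiLocalAtTarget.iff_of_iSup_eq_top
    (P := MorphismProperty.isomorphisms Scheme.{u}) (fun x ↦ (U x).toOpens) ?_).mpr fun x ↦ ?_
  · exact top_le_iff.mp fun x _ ↦ TopologicalSpace.Opens.mem_iSup.mpr ⟨x, hU x⟩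
  · exact isIso_toBase_restrict (U x) (hb x).some

end LocallyFree

/-! ### Regular varieties -/

section Regular

variable {k : Type u} [Field k] [IsAlgClosed k] [CharZero k] {X : Scheme.{u}} (f : X ⟶ Spec (.of k))
  [IsIntegral X] [LocallyOfFiniteType f]

lemma exists_basis_differentials {x : X} (hx : IsClosed {x}) (hreg : x ∈ regularLocus X) :
    ∃ U : X.AffineZariskiSite, x ∈ U.toOpens ∧
      Nonempty (Module.Basis (Fin (dim X)) Γ(X, U.toOpens) ((differentials f).sec U)) := by
  obtain ⟨_, ⟨V, hV, rfl⟩, hxV, -⟩ :=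
    X.isBasis_affineOpens.exists_subset_of_mem_open (Set.mem_univ x) isOpen_univ
  let V : X.AffineZariskiSite := ⟨V, hV⟩
  let := sectionsAlgebra f V
  have := isDomain_sections (U := V) hxV
  have := finiteType_sections f V
  have : (V.2.primeIdealOf ⟨x, hxV⟩).asIdeal.IsMaximal :=
    V.2.primeIdealOf_isMaximal_of_isClosed ⟨x, hxV⟩ hx
  let := X.presheaf.algebra_section_stalk (⟨x, hxV⟩ : V.toOpens)
  have : IsLocalization.AtPrime (X.presheaf.stalk x) (V.2.primeIdealOf ⟨x, hxV⟩).asIdeal :=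
    V.2.isLocalization_stalk ⟨x, hxV⟩
  have : IsRegularLocalRing (X.presheaf.stalk x) := hreg
  obtain ⟨t, g, hg, hspan⟩ := exists_smul_mem_span_of_isRegularLocalRing (k := k)
    (ringKrullDim_sections f (U := V) hxV) (V.2.primeIdealOf ⟨x, hxV⟩).asIdeal (X.presheaf.stalk x)
  have hxg : x ∈ (V.basicOpen g).toOpens := by
    have e := V.2.fromSpec_primeIdealOf ⟨x, hxV⟩
    have hmem : V.2.fromSpec (V.2.primeIdealOf ⟨x, hxV⟩) ∈ X.basicOpen g :=
      (V.2.fromSpec_preimage_basicOpen g).ge hg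
    rwa [e] at hmem
  have hW := span_res_of_smul_mem (F := differentials f) g t hspan
  let := sectionsAlgebra f (V.basicOpen g)
  have := isDomain_sections hxg
  have := finiteType_sections f (V.basicOpen g)
  have hfin := finrank_kaehlerDifferential_of_isDimension k (ringKrullDim_sections f hxg)
  refine ⟨V.basicOpen g, hxg, ⟨Module.Basis.mk (v := (differentials f).res (V.basicOpen_le g) ∘ t)
    ?_ hW.ge⟩⟩
  -- Generators as many as the rank, over a domain, are independent.
  exact linearIndependent_of_top_le_span_of_card_eq_finrank hW.ge
    ((Fintype.card_fin _).trans hfin.symm)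

/-- The points with such a neighbourhood form an open set. By compactness a nonempty complement
would contain a closed point, where regularity applies. -/
lemma exists_basis_differentials_of_isRegularVariety [QuasiCompact f] (h : IsRegularVariety X)
    (x : X) : ∃ U : X.AffineZariskiSite, x ∈ U.toOpens ∧
      Nonempty (Module.Basis (Fin (dim X)) Γ(X, U.toOpens) ((differentials f).sec U)) := by
  have : CompactSpace X := (quasiCompact_iff_compactSpace f).mp inferInstance
  let Z : Set X := {x | ∃ U : X.AffineZariskiSite, x ∈ U.toOpens ∧
      Nonempty (Module.Basis (Fin (dim X)) Γ(X, U.toOpens) ((differentials f).sec U))}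
  have hZ : IsOpen Z := isOpen_iff_forall_mem_open.mpr fun y ⟨U, hy, hb⟩ ↦
    ⟨U.toOpens, fun z hz ↦ ⟨U, hz, hb⟩, U.toOpens.2, hy⟩
  by_contra hx
  obtain ⟨y, hy, hyc⟩ := hZ.isClosed_compl.exists_closed_singleton ⟨x, hx⟩
  exact hy (exists_basis_differentials f hyc (h y hyc))

omit [IsAlgClosed k] [CharZero k] [LocallyOfFiniteType f] in
lemma genericPoint_mem_regularLocus : genericPoint X ∈ regularLocus X := by
  change IsRegularLocalRing X.functionField
  infer_instance

theorem isIso_nashToBase_of_isRegularVariety [QuasiCompact f] (h : IsRegularVariety X) :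
    IsIso (nashToBase f) := by
  have := isIso_toBase (exists_basis_differentials_of_isRegularVariety f h)
  let g := grassmannianToBase (differentials f) (dim X)
  have : IsReduced (grassmannian (differentials f) (dim X)) :=
    isReduced_of_isOpenImmersion g
  have : Surjective (nashι f) := ⟨by
    -- The structure morphism is open, so closure commutes with preimage; the regular locus is dense
    -- because it contains the generic point.
    rw [← Set.range_eq_univ, range_nashι,
      ← g.isOpenEmbedding.isOpenMap.preimage_closure_eq_closure_preimage g.continuous]
    have : closure (regularLocus X) = Set.univ := by
      refine Set.univ_subset_iff.mp ?_
      rw [← genericPoint_closure (α := X)]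
      exact closure_mono (Set.singleton_subset_iff.mpr genericPoint_mem_regularLocus)
    rw [this, Set.preimage_univ]⟩
  -- A surjective closed immersion into a reduced scheme is an isomorphism.
  have : IsIso (nashι f) := isIso_of_isClosedImmersion_of_surjective _
  rw [← nashι_toBase]
  infer_instance

end Regular

end NashModification

end

theorem theorem2p1 {k : Type u} [Field k] [IsAlgClosed k] [CharZero k]
    {X : Scheme.{u}} (f : X ⟶ Spec (.of k)) [IsIntegral X] [LocallyOfFiniteType f]
    [QuasiCompact f] :
    IsIso (NashModification.nashToBase f) ↔ NashModification.IsRegularVariety X :=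
  ⟨fun _ ↦ NashModification.isRegularVariety_of_isIso_nashToBase f,
    NashModification.isIso_nashToBase_of_isRegularVariety f⟩
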